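/- Let $d\ge 1$ and let $g:\mathbb{R}^d\to[0,1]$ be a connection function, i.e. $g(x)$ depends only on the Euclidean norm $\|x\|$ and $g(x)\ge g(y)$ whenever $\|x\|\le\|y\|$. For a discrete set $\mathcal{X}\subset\mathbb{R}^d$ let $G_g(\mathcal{X})$ be the random graph with vertex set $\mathcal{X}$ in which distinct $x,y$ are joined iff $U_{x,y}\le g(x-y)$, where the $U_{x,y}$ are independent uniform $[0,1]$ variables, one for each unordered pair, independent of $\mathcal{X}$ if $\mathcal{X}$ is random; for $S\subseteq\mathcal{X}$ let $G_g(S)$ be the subgraph induced by $S$. Write $\mathcal{X}^{\mathbf 0}=\mathcal{X}\cup\{\mathbf 0\}$. Let $\lambda\in(0,\infty)$ and $h>0$. Let $\eta$ be a homogeneous Poisson point process of intensity $\lambda$ on $\mathbb{R}^d$, declare each vertex of $G_g(\eta^{\mathbf 0})$ (including $\mathbf 0$) green with probability $1-e^{-h}$, independently of everything else, and let $m_h(\lambda)$ be the probability that the connected component of $\mathbf 0$ in $G_g(\eta^{\mathbf 0})$ contains a green vertex. Let $K\ge 1$ be an integer. For each integer $N\ge1$ let $\eta_N$ be a Poisson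 point process of intensity $N\lambda$ in the box $\Lambda_K=[-K/2,K/2)^d$, and let $\mathbb{P}_{N\lambda,g}$ denote the joint law of $\eta_N$ and the uniform variables attached to the pairs of points of $\eta_N^{\mathbf 0}$. Given $\eta_N$ and these variables, let $P_{1/N,h}$ denote the conditional law of an independent pair $(\omega_N,\mathcal{G})$, where $\omega_N\subseteq\eta_N$ contains each point of $\eta_N$ independently with probability $1/N$, and the set $\mathcal{G}\subseteq\eta_N^{\mathbf 0}$ of green vertices contains each point of $\eta_N^{\mathbf 0}$ independently with probability $1-e^{-h}$. Then for every $\delta>0$, $$ \mathbb{P}_{N\lambda,g}\Bigl(\ \sup_{x\in\eta_N^{\mathbf 0}} P_{1/N,h}\bigl[\,\text{the component of $x$ in } G_g(\omega_N\cup\{x\})\text{ contains a green vertex}\,\bigr] > m_h(\lambda)+\delta\ \Bigr)\longrightarrow 0\qquad\text{as } N\to\infty . $$ -/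

import Mathlib

open MeasureTheory ProbabilityTheory Filter Topology
open scoped NNReal ENNReal unitInterval

noncomputable section

namespace RCM

/-- Euclidean space `ℝ^d`. -/
abbrev Space (d : ℕ) : Type := EuclideanSpace ℝ (Fin d)

/-- A connection function `g : ℝ^d → [0,1]`: `‖x‖ ≤ ‖y‖` implies `g x ≥ g y`. Applied in both
directions when `‖x‖ = ‖y‖`, this also says that `g x` depends only on `‖x‖`. -/
structure ConnectionFunction (d : ℕ) where
  toFun : Space d → ℝ
  nonneg : ∀ x, 0 ≤ toFun x
  le_one : ∀ x, toFun x ≤ 1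
  anti : ∀ x y, ‖x‖ ≤ ‖y‖ → toFun y ≤ toFun x

/-- The half-open box `Λ_r = [-r/2, r/2)^d` of side length `r` centred at the origin. -/
def box (d : ℕ) (r : ℝ) : Set (Space d) :=
  {y | ∀ j, -(r / 2) ≤ y j ∧ y j < r / 2}

/-- The number of points (counted with multiplicity) that the sequence `X` has in `A`. -/
def count {d : ℕ} (A : Set (Space d)) (X : ℕ → Space d) : ℕ∞ :=
  {i | X i ∈ A}.encard

/-- `P` is the law of an enumeration `X 0, X 1, X 2, …` of the points of a homogeneous Poisson
point process of intensity `r` on `ℝ^d`: the number of points in a Borel set of finite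
volume is Poisson with mean `r * volume A`, and the numbers of points in pairwise disjoint
Borel sets are independent. (When `0 < d` and `0 < r` the process has almost surely infinitely
many, pairwise distinct points, so that it can be enumerated by `ℕ`.) -/
structure IsPoissonProcess {d : ℕ} (r : ℝ≥0) (P : Measure (ℕ → Space d)) : Prop where
  isProbabilityMeasure : IsProbabilityMeasure P
  hasLaw_count : ∀ A : Set (Space d), MeasurableSet A → volume A < ∞ →
    HasLaw (count A) ((poissonMeasure (r * (volume A).toNNReal)).map (Nat.cast : ℕ → ℕ∞)) P
  iIndepFun_count : ∀ (n : ℕ) (A : Fin n → Set (Space d)), (∀ i, MeasurableSet (A i)) →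
    Pairwise (Function.onFun Disjoint A) → iIndepFun (fun i => count (A i)) P

/-- Vertex labels of the model with the origin added: `none` is the origin (the root), and
`some i` is the `i`-th point of the point process. -/
abbrev Label : Type := Option ℕ

/-- The position of a labelled vertex. -/
def position {d : ℕ} (X : ℕ → Space d) : Label → Space d
  | none => 0
  | some i => X i

/-- A realisation `(X, U)`: the points of the process, and a number `U s(v, w) ∈ [0,1]` for
every unordered pair of vertices. (The values on the diagonal are never used.) -/
abbrev Config (d : ℕ) : Type := (ℕ → Space d) × (Sym2 Label → I)

/-- The joint law of the points (with law `P`) and of the independent uniform variables `U`,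
which are also independent of the points. -/
def rcmLaw {d : ℕ} (P : Measure (ℕ → Space d)) : Measure (Config d) :=
  P.prod (Measure.infinitePi fun _ : Sym2 Label => (volume : Measure I))

/-- The random graph `G_g(η ∪ {0})`: distinct `v`, `w` are joined iff `U_{v,w} ≤ g (v - w)`. -/
def graph {d : ℕ} (g : ConnectionFunction d) (c : Config d) : SimpleGraph Label where
  Adj v w := v ≠ w ∧ (c.2 s(v, w) : ℝ) ≤ g.toFun (position c.1 v - position c.1 w)
  symm := by
    constructor
    rintro v w ⟨hne, h⟩
    refine ⟨hne.symm, ?_⟩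
    rw [Sym2.eq_swap]
    exact h.trans (g.anti _ _ (by rw [norm_sub_rev]))
  loopless := ⟨fun _ h => h.1 rfl⟩

/-- In the subgraph of `G` induced by `S ∪ {v}`, the component of `v` contains a vertex of the
set `green`. The vertex `v` itself counts. -/
def ConnectedToGreen {V : Type*} (G : SimpleGraph V) (S green : Set V) (v : V) : Prop :=
  ∃ w : ↥(insert v S), (w : V) ∈ green ∧
    (G.induce (insert v S)).Reachable ⟨v, Set.mem_insert v S⟩ w

/-- The probability `1 - e^{-h}` that a vertex is green. -/
def greenProb (h : ℝ≥0) : I :=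
  ⟨1 - Real.exp (-h), by
    constructor
    · have : Real.exp (-(h : ℝ)) ≤ 1 := Real.exp_le_one_iff.2 (by simp)
      linarith
    · have := Real.exp_pos (-(h : ℝ))
      linarith⟩

/-- The site percolation parameter `1 / N`. -/
def siteProb (N : ℕ) : I :=
  ⟨1 / (N : ℝ), by
    constructor
    · positivity
    · rcases Nat.eq_zero_or_pos N with rfl | hN
      · simp
      · rw [div_le_one (by exact_mod_cast hN)]
        exact_mod_cast hN⟩

/-- `m_h`: the probability that the component of the origin in `G_g(η ∪ {0})` contains a green
vertex, where `η` is the process on all of `ℝ^d` with law `P`, and each vertex (the origin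
included) is green with probability `1 - e^{-h}`, independently of everything else. -/
def meanGreen {d : ℕ} (g : ConnectionFunction d) (P : Measure (ℕ → Space d)) (h : ℝ≥0) : ℝ :=
  ((rcmLaw P).prod (setBernoulli (Set.univ : Set Label) (greenProb h))).real
    {z | ConnectedToGreen (graph g z.1) Set.univ z.2 none}

/-- The law of `(ω, green)` for site percolation with a ghost field on the vertex set `W` with
root `ρ`: every vertex of `W` other than `ρ` belongs to `ω` with probability `p`, every vertex
of `W` is green with probability `q`, all independently. -/
def percolationLaw {V : Type*} (W : Set V) (ρ : V) (p q : I) : Measure (Set V × Set V) :=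
  (setBernoulli (W \ {ρ}) p).prod (setBernoulli W q)

/-- The vertex set `(η ∩ Λ_K) ∪ {0}` of the model in the box `Λ_K`. -/
def boxVertices {d : ℕ} (K : ℕ) (c : Config d) : Set Label :=
  insert none {v | ∃ i : ℕ, v = some i ∧ c.1 i ∈ box d K}

/-- The conditional probability, given the points and the edges of the graph in `Λ_K`, that `v`
is connected to a green vertex in the subgraph induced by `ω ∪ {v}`, for site
percolation `ω` with parameter `1 / N` rooted at the origin. -/
def condGreen {d : ℕ} (g : ConnectionFunction d) (K N : ℕ) (h : ℝ≥0) (c : Config d)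
    (v : Label) : ℝ :=
  (percolationLaw (boxVertices K c) none (siteProb N) (greenProb h)).real
    {z | ConnectedToGreen (graph g c) z.1 z.2 v}

end RCM

end

/-! Condition on the number n of points in the box `Λ_K`. Given n, the points are independent and
uniform, and with μ = λ·|Λ_K| the count n lies within a small multiple of N of Nμ outside an event
of exponentially small probability. For fixed n the quenched probability at a vertex is a function
`siteGreen` of a finite random graph, controlled by its fluctuations and its mean.

Fluctuations: resampling one point together with its edges matters only for those ω that contain the
point, so `siteGreen` moves by at most 1/N (`abs_siteGreen_sub_le`). There are of order N
independent coordinates, so the bounded differences inequality gives probability at most exp(-cN) to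
an upward deviation of δ/2 (`modelLaw_real_ge_le`). This beats a union bound over the O(N) vertices
(`modelLaw_exists_le`); a vertex other than the origin is treated as a root at a given position z,
the remaining points staying independent and uniform.

Mean: averaging over the graph as well turns ω into a binomial number of uniform points, with mean
close to μ (`integral_siteGreen`). Up to a small error a binomial expectation is at most the Poisson
one (`sum_binomial_le_of_sum_poisson_le`). The latter is the probability that the component of z in
the Poisson model restricted to the box contains a green vertex. Translating z to the origin and
enlarging the box to the whole space can only increase it, so it is at most m_h(λ), uniformly in z
(`sum_annealedGreen_le_meanGreen`).

The Poisson process is given through its counts only; the conditional uniformity of its points is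
derived in `IsPoissonProcess.tupleMeasure_eq`. -/

namespace RCM

/-! ### Components in induced subgraphs -/

section Cluster

variable {V W : Type*}

/-- The component of `v` in the subgraph of `G` induced by `S ∪ {v}`. -/
def cluster (G : SimpleGraph V) (S : Set V) (v : V) : Set V :=
  {w | Relation.ReflTransGen (fun a b => a ∈ insert v S ∧ b ∈ insert v S ∧ G.Adj a b) v w}

theorem cluster_subset (G : SimpleGraph V) (S : Set V) (v : V) : cluster G S v ⊆ insert v S := by
  intro w hw
  induction hw with
  | refl => exact Set.mem_insert _ _
  | tail _ h _ => exact h.2.1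

/-- Trades reachability in a subtype depending on `S` for a relation on the ambient vertex set,
where different `S` and different graphs can be compared directly. -/
theorem connectedToGreen_iff (G : SimpleGraph V) (S green : Set V) (v : V) :
    ConnectedToGreen G S green v ↔ (cluster G S v ∩ green).Nonempty := by
  constructor
  · rintro ⟨w, hw, hr⟩
    refine ⟨w, ?_, hw⟩
    rw [SimpleGraph.reachable_iff_reflTransGen] at hr
    exact Relation.ReflTransGen.lift (p := fun a b => a ∈ insert v S ∧ b ∈ insert v S ∧ G.Adj a b)
      (fun a : ↥(insert v S) => (a : V)) (fun a b hab => ⟨a.2, b.2, hab⟩) _ _ hr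
  · rintro ⟨w, hw, hg⟩
    have key : ∀ w, w ∈ cluster G S v → ∃ hw' : w ∈ insert v S,
        (G.induce (insert v S)).Reachable ⟨v, Set.mem_insert v S⟩ ⟨w, hw'⟩ := by
      intro w hw
      induction hw with
      | refl => exact ⟨Set.mem_insert _ _, SimpleGraph.Reachable.refl _⟩
      | tail _ h ih =>
        obtain ⟨_, hr⟩ := ih
        exact ⟨h.2.1, hr.trans (SimpleGraph.Adj.reachable (G := G.induce (insert v S)) h.2.2)⟩
    obtain ⟨hw', hr⟩ := key w hw
    exact ⟨⟨w, hw'⟩, hg, hr⟩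

theorem cluster_mono (G : SimpleGraph V) {S T : Set V} (h : S ⊆ T) (v : V) :
    cluster G S v ⊆ cluster G T v := fun _ hw =>
  Relation.ReflTransGen.mono (fun _ _ hab => ⟨Set.insert_subset_insert h hab.1,
    Set.insert_subset_insert h hab.2.1, hab.2.2⟩) _ _ hw

theorem cluster_congr {G H : SimpleGraph V} {S T : Set V} {v : V}
    (hST : insert v S = insert v T)
    (h : ∀ a ∈ insert v S, ∀ b ∈ insert v S, G.Adj a b ↔ H.Adj a b) :
    cluster G S v = cluster H T v := by
  have : (fun a b => a ∈ insert v S ∧ b ∈ insert v S ∧ G.Adj a b) =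
      (fun a b => a ∈ insert v T ∧ b ∈ insert v T ∧ H.Adj a b) := by
    rw [← hST]
    ext a b
    exact ⟨fun hab => ⟨hab.1, hab.2.1, (h a hab.1 b hab.2.1).1 hab.2.2⟩,
      fun hab => ⟨hab.1, hab.2.1, (h a hab.1 b hab.2.1).2 hab.2.2⟩⟩
  unfold cluster
  rw [this]

theorem cluster_image (G : SimpleGraph W) {f : V → W} (hf : f.Injective) (S : Set V) (v : V) :
    cluster G (f '' S) (f v) = f '' cluster (G.comap f) S v := by
  have hins : insert (f v) (f '' S) = f '' insert v S := (Set.image_insert_eq).symm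
  ext w
  constructor
  · intro hw
    induction hw with
    | refl => exact ⟨v, Relation.ReflTransGen.refl, rfl⟩
    | tail _ h ih =>
      obtain ⟨a, ha, rfl⟩ := ih
      obtain ⟨h1, h2, h3⟩ := h
      rw [hins] at h1 h2
      obtain ⟨b, hb, rfl⟩ := h2
      rw [hf.mem_set_image] at h1
      exact ⟨b, Relation.ReflTransGen.tail ha ⟨h1, hb, h3⟩, rfl⟩
  · rintro ⟨w, hw, rfl⟩
    refine Relation.ReflTransGen.lift f (fun a b hab => ?_) _ _ hw
    rw [hins]
    exact ⟨Set.mem_image_of_mem f hab.1, Set.mem_image_of_mem f hab.2.1, hab.2.2⟩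

end Cluster

/-! ### Random subsets and the ghost field -/

section SetBernoulli

variable {V : Type*} [Countable V]

theorem measurableSet_inter_nonempty (C : Set V) :
    MeasurableSet {s : Set V | (C ∩ s).Nonempty} := by
  have : {s : Set V | (C ∩ s).Nonempty} = ⋃ w ∈ C, {s : Set V | w ∈ s} := by
    ext s
    simp [Set.Nonempty]
  rw [this]
  exact MeasurableSet.biUnion C.to_countable fun w _ => measurableSet_setOfPred.2 (by fun_prop)

theorem setBernoulli_real_inter_nonempty {C W : Set V} (hCW : C ⊆ W) (hC : C.Finite) (q : I) :
    (setBernoulli W q).real {s | (C ∩ s).Nonempty} = 1 - (1 - (q : ℝ)) ^ C.ncard := by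
  have hcompl : (setBernoulli W q).real {s | (C ∩ s).Nonempty}ᶜ = (1 - (q : ℝ)) ^ C.ncard := by
    lift C to Finset V using hC
    have hpre : ((fun p : V → Prop ↦ {i | p i}) ⁻¹' {s : Set V | ((C : Set V) ∩ s).Nonempty}ᶜ) =
        Set.pi (C : Set V) (fun _ => {False}) := by
      ext s
      simp [Set.Nonempty, Set.pi]
    rw [measureReal_def, setBernoulli_apply', hpre, Measure.infinitePi_pi _ (by simp)]
    rw [Finset.prod_congr rfl (g := fun _ => (unitInterval.toNNReal (unitInterval.symm q) : ℝ≥0∞))]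
    · simp
    · intro i hi
      have : i ∈ W := hCW hi
      simp [this]
  rw [← hcompl, probReal_compl_eq_one_sub (measurableSet_inter_nonempty C)]
  ring

/-- Almost surely ω is one of the finitely many subsets of `W \ {ρ}`, so up to a null set the event
is a finite disjoint union of rectangles. No regularity of `C` is needed. -/
theorem percolationLaw_real_eq_sum {W : Set V} (hW : W.Finite) (ρ : V) (p q : I)
    (C : Set V → Set V) (hC : ∀ s ⊆ W \ {ρ}, C s ⊆ W) (F : Finset V) (hF : W \ {ρ} = F) :
    (percolationLaw W ρ p q).real {z | (C z.1 ∩ z.2).Nonempty} =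
      ∑ s ∈ F.powerset, (p : ℝ) ^ s.card * (1 - (p : ℝ)) ^ (F.card - s.card) *
        (1 - (1 - (q : ℝ)) ^ (C s).ncard) := by
  set T : Set (Set V × Set V) := {z | (C z.1 ∩ z.2).Nonempty}
  have hsing : ∀ s : Set V, MeasurableSet {s} := fun s => by
    have : {s} = ⋂ v : V, {t : Set V | v ∈ t ↔ v ∈ s} := by
      ext t
      simp [Set.ext_iff]
    rw [this]
    exact MeasurableSet.iInter fun v => measurableSet_setOfPred.2 (by fun_prop)
  have hae : ∀ᵐ z ∂(percolationLaw W ρ p q), z.1 ⊆ W \ {ρ} :=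
    Measure.quasiMeasurePreserving_fst.ae setBernoulli_ae_subset
  have hprob : IsProbabilityMeasure (percolationLaw W ρ p q) := by
    unfold percolationLaw; infer_instance
  have hT : (percolationLaw W ρ p q).real T = (percolationLaw W ρ p q).real
      (⋃ s ∈ F.powerset, {(s : Set V)} ×ˢ {t | (C s ∩ t).Nonempty}) := by
    refine measureReal_congr ?_
    filter_upwards [hae] with z hz
    refine propext ⟨fun h => ?_, fun h => ?_⟩
    · have h' : (C z.1 ∩ z.2).Nonempty := h
      have hfin : (z.1).Finite := (hF ▸ F.finite_toSet : (W \ {ρ}).Finite).subset hz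
      refine Set.mem_biUnion (x := hfin.toFinset) ?_ ?_
      · simp only [Finset.coe_powerset, Set.mem_preimage, Set.mem_powerset_iff,
          Set.Finite.coe_toFinset]
        rw [← hF]; exact hz
      · simpa [Set.mem_prod] using h'
    · obtain ⟨s, _, h1, h2⟩ := Set.mem_iUnion₂.1 h
      have h1' : z.1 = s := h1
      change (C z.1 ∩ z.2).Nonempty
      rw [h1']
      exact h2
  rw [hT, measureReal_biUnion_finset]
  · refine Finset.sum_congr rfl fun s hs => ?_
    have hs' : (s : Set V) ⊆ W \ {ρ} := by
      rw [hF]; exact_mod_cast Finset.mem_powerset.1 hs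
    unfold percolationLaw
    rw [measureReal_prod_prod, setBernoulli_real_singleton p hs' (hF ▸ F.finite_toSet),
      setBernoulli_real_inter_nonempty (hC _ hs') (hW.subset (hC _ hs')),
      Set.ncard_sdiff hs' s.finite_toSet, hF, Set.ncard_coe_finset, Set.ncard_coe_finset]
  · intro s _ t _ hst
    refine Set.disjoint_left.2 fun z hz hz' => hst ?_
    exact Finset.coe_injective ((hz.1 : z.1 = s).symm.trans hz'.1)
  · exact fun s _ => (hsing _).prod (measurableSet_inter_nonempty _)

end SetBernoulli

/-! ### The quenched probability as a finite sum -/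

section SiteGreen

/-- The probability that the component of `v` contains a green vertex, for site percolation with
parameter `p` on a finite vertex set with an added root `none`. -/
noncomputable def siteGreen {n : ℕ} (p q : ℝ) (G : SimpleGraph (Option (Fin n)))
    (v : Option (Fin n)) : ℝ :=
  ∑ s : Finset (Fin n), p ^ s.card * (1 - p) ^ (n - s.card) *
    (1 - (1 - q) ^ (cluster G (some '' (s : Set (Fin n))) v).ncard)

/-- The random connection graph on vertices at positions `y`, with edge variables `U`. -/
def connGraph {d : ℕ} {V : Type*} (g : ConnectionFunction d) (y : V → Space d)
    (U : Sym2 V → I) : SimpleGraph V where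
  Adj v w := v ≠ w ∧ (U s(v, w) : ℝ) ≤ g.toFun (y v - y w)
  symm := by
    constructor
    rintro v w ⟨hne, h⟩
    refine ⟨hne.symm, ?_⟩
    rw [Sym2.eq_swap]
    exact h.trans (g.anti _ _ (by rw [norm_sub_rev]))
  loopless := ⟨fun _ h => h.1 rfl⟩

/-- The positions of `n` points and a root. -/
def rooted {d n : ℕ} (z : Space d) (x : Fin n → Space d) (v : Option (Fin n)) : Space d :=
  v.elim z x

theorem graph_comap {d n : ℕ} (g : ConnectionFunction d) (c : Config d) (i : Fin n ↪ ℕ) :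
    (graph g c).comap (Option.map i) =
      connGraph g (rooted 0 (c.1 ∘ i)) (c.2 ∘ Sym2.map (Option.map i)) := by
  have hpos : ∀ v, position c.1 (Option.map i v) = rooted 0 (c.1 ∘ i) v := by
    rintro (_ | v) <;> rfl
  ext v w
  simp only [SimpleGraph.comap_adj, graph, connGraph, hpos, Function.comp, Sym2.map_mk,
    (Option.map_injective i.injective).ne_iff]

theorem connGraph_comap {d : ℕ} {V W : Type*} (g : ConnectionFunction d) (y : W → Space d)
    (U : Sym2 W → I) {f : V → W} (hf : f.Injective) :
    (connGraph g y U).comap f = connGraph g (y ∘ f) (U ∘ Sym2.map f) := by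
  ext v w
  simp [connGraph, hf.ne_iff]

theorem sum_powerset_map {α β M : Type*} [AddCommMonoid M] (j : α ↪ β) (F : Finset α)
    (f : Finset β → M) : ∑ s ∈ (F.map j).powerset, f s = ∑ s ∈ F.powerset, f (s.map j) := by
  have : (F.map j).powerset = F.powerset.map (Finset.mapEmbedding j).toEmbedding := by
    ext s
    simp only [Finset.mem_powerset, Finset.subset_map_iff, Finset.mem_map,
      RelEmbedding.coe_toEmbedding, Finset.mapEmbedding_apply]
    exact ⟨fun ⟨u, hu, h⟩ => ⟨u, hu, h.symm⟩, fun ⟨u, hu, h⟩ => ⟨u, hu, h.symm⟩⟩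
  rw [this, Finset.sum_map]
  rfl

theorem condGreen_eq {d : ℕ} (g : ConnectionFunction d) (K N : ℕ) (h : ℝ≥0) (c : Config d)
    {n : ℕ} (i : Fin n ↪ ℕ) (hi : Set.range i = {j | c.1 j ∈ box d K}) (u : Option (Fin n)) :
    condGreen g K N h c (Option.map i u) =
      siteGreen (siteProb N) (greenProb h) ((graph g c).comap (Option.map i)) u := by
  have hW : boxVertices K c = insert none (some '' Set.range i) := by
    rw [hi]
    unfold boxVertices
    congr 1
    ext v
    simp [eq_comm, and_comm]
  have hσ := Option.map_injective i.injective
  set j : Fin n ↪ Label := i.trans ⟨some, Option.some_injective _⟩ with hj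
  have hdiff : boxVertices K c \ {none} = ((Finset.univ.map j : Finset Label) : Set Label) := by
    rw [hW]
    ext v
    cases v <;> simp [hj]
  have hu : Option.map i u ∈ boxVertices K c := by
    rw [hW]
    cases u <;> simp
  have himg : ∀ s : Finset (Fin n), ((s.map j : Finset Label) : Set Label) =
      Option.map i '' (some '' (s : Set (Fin n))) := by
    intro s
    ext v
    simp [hj]
  unfold condGreen
  simp_rw [connectedToGreen_iff]
  rw [percolationLaw_real_eq_sum _ none _ _ (fun s => cluster (graph g c) s (Option.map i u)) _
    _ hdiff]
  · rw [sum_powerset_map, Finset.powerset_univ]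
    refine Finset.sum_congr rfl fun s _ => ?_
    rw [himg, cluster_image _ hσ, Set.ncard_image_of_injective _ hσ, Finset.card_map,
      Finset.card_map, Finset.card_univ, Fintype.card_fin]
  · rw [hW]
    exact ((Set.finite_range i).image _).insert _
  · intro s hs
    exact (cluster_subset _ _ _).trans (Set.insert_subset hu (hs.trans Set.sdiff_subset))

/-- The `n + 1` vertices of which the `k`-th is taken as the root. -/
def rerooted {m : ℕ} (k : Fin (m + 1)) (v : Option (Fin m)) : Option (Fin (m + 1)) :=
  some (v.elim k k.succAbove)

theorem rerooted_injective {m : ℕ} (k : Fin (m + 1)) : (rerooted k).Injective := by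
  rintro (_ | a) (_ | b) h
  · rfl
  · exact absurd (Option.some_injective _ h).symm (Fin.succAbove_ne k b)
  · exact absurd (Option.some_injective _ h) (Fin.succAbove_ne k a)
  · exact congrArg some (Fin.succAbove_right_injective (Option.some_injective _ h))

/-- A vertex is always added to ω when its own component is formed, so the subsets with and without
`k` pair up and their weights add to the factor p + (1 - p) = 1. The old root belongs to no ω and
drops out. -/
theorem siteGreen_some {m : ℕ} (p q : ℝ) (G : SimpleGraph (Option (Fin (m + 1))))
    (k : Fin (m + 1)) :
    siteGreen p q G (some k) = siteGreen p q (G.comap (rerooted k)) none := by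
  have hcl : ∀ (s : Finset (Fin m)) (T : Finset (Fin (m + 1))),
      insert k T = insert k (s.map k.succAboveEmb) →
      (cluster G (some '' (T : Set (Fin (m + 1)))) (some k)).ncard =
      (cluster (G.comap (rerooted k)) (some '' (s : Set (Fin m))) none).ncard := by
    intro s T hT
    have hT' : insert (some k) (some '' (T : Set (Fin (m + 1)))) =
        insert (some k) (rerooted k '' (some '' (s : Set (Fin m)))) := by
      rw [← Set.image_insert_eq, ← Finset.coe_insert, hT]
      ext v
      simp [rerooted, eq_comm]
    rw [cluster_congr hT' (H := G) (fun _ _ _ _ => Iff.rfl),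
      show some k = rerooted k none from rfl, cluster_image G (rerooted_injective k),
      Set.ncard_image_of_injective _ (rerooted_injective k)]
  have hk : k ∉ Finset.univ.map k.succAboveEmb := by simp [Fin.succAbove_ne]
  have hk' : ∀ s : Finset (Fin m), k ∉ s.map k.succAboveEmb := by simp [Fin.succAbove_ne]
  have hcard : ∀ s : Finset (Fin m), s.card ≤ m := fun s => by simpa using s.card_le_univ
  unfold siteGreen
  rw [← Finset.powerset_univ, Fin.univ_succAbove _ k, Finset.cons_eq_insert,
    Finset.sum_powerset_insert hk, sum_powerset_map, sum_powerset_map,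
    Finset.powerset_univ, ← Finset.sum_add_distrib]
  refine Finset.sum_congr rfl fun s _ => ?_
  rw [hcl s _ rfl, hcl s _ (Finset.insert_idem _ _), Finset.card_insert_of_notMem (hk' s),
    Finset.card_map, show m + 1 - s.card = m - s.card + 1 by have := hcard s; omega,
    show m + 1 - (s.card + 1) = m - s.card by omega]
  ring

end SiteGreen

/-! ### Points of a Poisson process given their number -/

section Poisson

variable {d : ℕ} {r : ℝ≥0} {P : Measure (ℕ → Space d)}

theorem measurable_count {A : Set (Space d)} (hA : MeasurableSet A) :
    Measurable (count A) := by
  have h : Measurable fun X : ℕ → Space d => {i | X i ∈ A} := by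
    refine measurable_set_iff.2 fun i => ?_
    exact hA.mem.comp (measurable_pi_apply i)
  exact Measurable.comp (g := Set.encard) (by fun_prop) h

/-- The mean number of points in `A`. -/
noncomputable def meanCount (r : ℝ≥0) (A : Set (Space d)) : ℝ≥0 := r * (volume A).toNNReal

theorem coe_meanCount {A : Set (Space d)} (hA : volume A ≠ ∞) :
    (meanCount r A : ℝ≥0∞) = r * volume A := by
  simp [meanCount, ENNReal.coe_toNNReal hA]

theorem IsPoissonProcess.measure_count_eq (hP : IsPoissonProcess r P) {A : Set (Space d)}
    (hA : MeasurableSet A) (hA' : volume A ≠ ∞) (n : ℕ) :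
    P {X | count A X = n} = ENNReal.ofReal (Real.exp (-meanCount r A)) * (r * volume A) ^ n /
      n.factorial := by
  have h := (hP.hasLaw_count A hA hA'.lt_top).map_eq
  have h1 : P {X | count A X = n} = (P.map (count A)) {(n : ℕ∞)} := by
    rw [Measure.map_apply (measurable_count hA) (measurableSet_singleton _)]
    rfl
  rw [h1, h, Measure.map_apply (by fun_prop) (measurableSet_singleton _)]
  have h2 : (Nat.cast : ℕ → ℕ∞) ⁻¹' {(n : ℕ∞)} = {n} := by ext; simp
  rw [h2, poissonMeasure_singleton, ← coe_meanCount hA', ENNReal.ofReal_div_of_pos (by positivity),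
    ENNReal.ofReal_mul (by positivity), ENNReal.ofReal_pow (by positivity)]
  simp [meanCount]

theorem range_eq_of_count_eq {n : ℕ} {B : Set (Space d)} {X : ℕ → Space d}
    (hX : count B X = n) (i : Fin n ↪ ℕ) (hi : ∀ j, X (i j) ∈ B) :
    Set.range i = {j | X j ∈ B} := by
  have hfin : {j | X j ∈ B}.Finite := by
    rw [← Set.encard_ne_top_iff]
    exact ne_of_eq_of_ne hX (by simp)
  refine hfin.eq_of_subset_of_encard_le' (s := Set.range i) (fun k ⟨j, hj⟩ => hj ▸ hi j) ?_
  have h1 : (Set.range i).encard = n := by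
    rw [← Set.image_univ, i.injective.encard_image]; simp
  rw [h1]
  exact le_of_eq hX

/-- Converts a statement about labelled points into one about counts, the only quantities whose law
is prescribed. -/
theorem iUnion_tuples_eq {n : ℕ} {B : Set (Space d)} {A : Fin n → Set (Space d)}
    (hAB : ∀ j, A j ⊆ B) (hA : Pairwise (Function.onFun Disjoint A)) :
    (⋃ i : Fin n ↪ ℕ, {X : ℕ → Space d | count B X = n ∧ ∀ j, X (i j) ∈ A j}) =
      {X | count (B \ ⋃ j, A j) X = 0 ∧ ∀ j, count (A j) X = 1} := by
  ext X
  simp only [Set.mem_iUnion, Set.mem_ofPred_eq]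
  constructor
  · rintro ⟨i, hB, hi⟩
    have hr := range_eq_of_count_eq hB i fun j => hAB j (hi j)
    have huniq : ∀ k, X k ∈ B → ∃ l, i l = k := fun k hk => by
      have : k ∈ Set.range i := hr ▸ hk
      exact this
    refine ⟨?_, fun j => ?_⟩
    · refine Set.encard_eq_zero.2 (Set.eq_empty_of_forall_notMem fun k hk => ?_)
      obtain ⟨l, rfl⟩ := huniq k hk.1
      exact hk.2 (Set.mem_iUnion.2 ⟨l, hi l⟩)
    · refine Set.encard_eq_one.2 ⟨i j, Set.eq_singleton_iff_unique_mem.2 ⟨hi j, fun k hk => ?_⟩⟩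
      obtain ⟨l, rfl⟩ := huniq k (hAB j hk)
      by_contra hne
      have hlj : l ≠ j := fun h => hne (by rw [h])
      exact Set.disjoint_left.1 (hA hlj) (hi l) hk
  · rintro ⟨h0, h1⟩
    choose i hi using fun j => Set.encard_eq_one.1 (h1 j)
    have hmem : ∀ j, X (i j) ∈ A j := fun j => by
      have : i j ∈ {k | X k ∈ A j} := by rw [hi j]; rfl
      exact this
    have hinj : i.Injective := fun a b hab => by
      by_contra hne
      exact Set.disjoint_left.1 (hA hne) (hmem a) (hab ▸ hmem b)
    refine ⟨⟨i, hinj⟩, ?_, hmem⟩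
    have : {k | X k ∈ B} = Set.range i := by
      refine Set.Subset.antisymm (fun k hk => ?_) (Set.range_subset_iff.2 fun j => hAB j (hmem j))
      by_contra hne
      have : k ∈ {k | X k ∈ B \ ⋃ j, A j} := by
        refine ⟨hk, fun hk' => hne ?_⟩
        obtain ⟨j, hj⟩ := Set.mem_iUnion.1 hk'
        have : k ∈ {k | X k ∈ A j} := hj
        rw [hi j] at this
        exact ⟨j, this.symm⟩
      rw [Set.encard_eq_zero.1 h0] at this
      exact this
    unfold count
    rw [this, ← Set.image_univ, hinj.encard_image]
    simp

instance (n : ℕ) : Countable (Fin n ↪ ℕ) := DFunLike.coe_injective.countable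

theorem measurableSet_tuples {n : ℕ} {B : Set (Space d)} (hB : MeasurableSet B)
    {S : Set (Fin n → Space d)} (hS : MeasurableSet S) (i : Fin n ↪ ℕ) :
    MeasurableSet {X : ℕ → Space d | count B X = n ∧ X ∘ i ∈ S} := by
  refine (measurable_count hB (measurableSet_singleton (n : ℕ∞))).inter ?_
  exact (measurable_pi_lambda (fun X : ℕ → Space d => X ∘ i) fun j => measurable_pi_apply (i j)) hS

/-- Disjoint cells determine the labelling, so the events for different `i` are disjoint and the sum
is the probability of a single count event. Independence of the counts factorises it, and the
exponential factors recombine because the volumes of the cells and of the remainder add up to that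
of `B`. -/
theorem IsPoissonProcess.tsum_tuples_disjoint (hP : IsPoissonProcess r P) {n : ℕ}
    {B : Set (Space d)} (hB : MeasurableSet B) (hB' : volume B ≠ ∞) {A : Fin n → Set (Space d)}
    (hAm : ∀ j, MeasurableSet (A j)) (hAB : ∀ j, A j ⊆ B)
    (hA : Pairwise (Function.onFun Disjoint A)) :
    ∑' i : Fin n ↪ ℕ, P {X | count B X = n ∧ ∀ j, X (i j) ∈ A j} =
      ENNReal.ofReal (Real.exp (-meanCount r B)) * ∏ j, (r * volume (A j)) := by
  rw [← measure_iUnion, iUnion_tuples_eq hAB hA]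
  · have hArest : MeasurableSet (B \ ⋃ j, A j) := hB.diff (MeasurableSet.iUnion hAm)
    have hfin : ∀ j, volume (A j) ≠ ∞ := fun j =>
      ((measure_mono (hAB j)).trans_lt hB'.lt_top).ne
    have hfin' : volume (B \ ⋃ j, A j) ≠ ∞ :=
      ((measure_mono Set.sdiff_subset).trans_lt hB'.lt_top).ne
    -- Cell 0 is the part of `B` outside all the `A j`; it has to be empty.
    set A' : Fin (n + 1) → Set (Space d) := Fin.cons (B \ ⋃ j, A j) A with hA'
    have hind := hP.iIndepFun_count (n + 1) A' (by
      intro j; cases j using Fin.cases <;> simp [hA', hArest, hAm]) (by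
      intro j k hjk
      cases j using Fin.cases <;> cases k using Fin.cases
      · exact absurd rfl hjk
      · rename_i k
        simp only [Function.onFun, hA', Fin.cons_zero, Fin.cons_succ]
        exact Set.disjoint_left.2 fun x hx hx' => hx.2 (Set.mem_iUnion.2 ⟨k, hx'⟩)
      · rename_i k
        simp only [Function.onFun, hA', Fin.cons_zero, Fin.cons_succ]
        exact Set.disjoint_left.2 fun x hx' hx => hx.2 (Set.mem_iUnion.2 ⟨k, hx'⟩)
      · rename_i k l
        simp only [Function.onFun, hA', Fin.cons_succ]
        exact hA fun h => hjk (by rw [h]))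
    have h := hind.measure_inter_preimage_eq_mul Finset.univ
      (sets := Fin.cons {0} fun _ => {1}) (fun _ _ => MeasurableSet.of_discrete)
    have hset : {X | count (B \ ⋃ j, A j) X = 0 ∧ ∀ j, count (A j) X = 1} =
        ⋂ j ∈ Finset.univ, count (A' j) ⁻¹' (Fin.cons {0} (fun _ => {1}) : Fin (n+1) → Set ℕ∞) j := by
      ext X
      simp [Fin.forall_fin_succ, hA']
    have h0 := hP.measure_count_eq hArest hfin' 0
    have h1 := fun j => hP.measure_count_eq (hAm j) (hfin j) 1
    simp only [pow_zero, mul_one, Nat.factorial_zero, Nat.cast_one, div_one, pow_one,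
      Nat.factorial_one, Nat.cast_zero] at h0 h1
    rw [hset, h, Fin.prod_univ_succ]
    simp only [hA', Fin.cons_zero, Fin.cons_succ]
    change P {X | count (B \ ⋃ j, A j) X = 0} * ∏ j, P {X | count (A j) X = 1} = _
    rw [h0, Finset.prod_congr rfl fun j _ => h1 j, Finset.prod_mul_distrib, ← mul_assoc,
      ← ENNReal.ofReal_prod_of_nonneg (fun _ _ => by positivity),
      ← ENNReal.ofReal_mul (by positivity), ← Real.exp_sum, ← Real.exp_add]
    congr 4
    have hvol : volume B = volume (B \ ⋃ j, A j) + ∑ j, volume (A j) := by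
      rw [← measure_sdiff_add_inter B (MeasurableSet.iUnion hAm),
        Set.inter_eq_self_of_subset_right (Set.iUnion_subset hAB), measure_iUnion hA hAm,
        tsum_fintype]
    have : meanCount r B = meanCount r (B \ ⋃ j, A j) + ∑ j, meanCount r (A j) := by
      rw [← ENNReal.coe_inj]
      push_cast
      simp only [coe_meanCount hB', coe_meanCount hfin', coe_meanCount (hfin _)]
      rw [hvol, mul_add, Finset.mul_sum]
    rw [this]
    push_cast
    rw [Finset.sum_neg_distrib]
    ring
  · intro i i' hii'
    refine Set.disjoint_left.2 fun X hX hX' => hii' ?_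
    ext j
    have hr := range_eq_of_count_eq hX.1 i fun j => hAB j (hX.2 j)
    have hr' := range_eq_of_count_eq hX'.1 i' fun j => hAB j (hX'.2 j)
    obtain ⟨l, hl⟩ : i j ∈ Set.range i' := by rw [hr', ← hr]; exact ⟨j, rfl⟩
    by_cases hlj : l = j
    · rw [← hl, hlj]
    · exact absurd (hX.2 j) (hl ▸ Set.disjoint_left.1 (hA hlj) (hX'.2 l))
  · intro i
    have : {X : ℕ → Space d | count B X = n ∧ ∀ j, X (i j) ∈ A j} =
        {X | count B X = n ∧ X ∘ i ∈ Set.univ.pi A} := by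
      ext X; simp
    rw [this]
    exact measurableSet_tuples hB (MeasurableSet.univ_pi hAm) i

/-- The sum over all `n`-tuples of distinct labels of the law of the corresponding points in `B`,
on the event that there are exactly `n` points in `B`. -/
noncomputable def tupleMeasure (P : Measure (ℕ → Space d)) (B : Set (Space d)) (n : ℕ) :
    Measure (Fin n → Space d) :=
  Measure.sum fun i : Fin n ↪ ℕ =>
    (P.restrict ({X | count B X = n} ∩ {X | ∀ j, X (i j) ∈ B})).map fun X => X ∘ i

theorem measurable_comp_embedding {n : ℕ} (i : Fin n ↪ ℕ) :
    Measurable fun X : ℕ → Space d => X ∘ i :=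
  measurable_pi_lambda _ fun j => measurable_pi_apply (i j)

theorem measurableSet_forall_mem {n : ℕ} {B : Set (Space d)} (hB : MeasurableSet B)
    (i : Fin n ↪ ℕ) : MeasurableSet {X : ℕ → Space d | ∀ j, X (i j) ∈ B} := by
  have : {X : ℕ → Space d | ∀ j, X (i j) ∈ B} = ⋂ j, {X | X (i j) ∈ B} := by ext; simp
  rw [this]
  exact MeasurableSet.iInter fun j => measurable_pi_apply (i j) hB

theorem measurableSet_count_eq {B : Set (Space d)} (hB : MeasurableSet B) (n : ℕ) :
    MeasurableSet {X : ℕ → Space d | count B X = n} :=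
  measurable_count hB (measurableSet_singleton (n : ℕ∞))

theorem tsum_indicator_embedding {n : ℕ} {B : Set (Space d)} {X : ℕ → Space d}
    (hX : count B X = n) :
    ∑' i : Fin n ↪ ℕ, {X : ℕ → Space d | ∀ j, X (i j) ∈ B}.indicator (1 : (ℕ → Space d) → ℝ≥0∞) X =
      n.factorial := by
  classical
  set S : Set ℕ := {k | X k ∈ B} with hS
  have hfin : S.Finite := by
    rw [← Set.encard_ne_top_iff]
    exact ne_of_eq_of_ne hX (by simp)
  have : Fintype S := hfin.fintype
  have hcard : Fintype.card S = n := by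
    have : S.encard = n := hX
    rw [Set.encard_eq_coe_toFinset_card, Set.toFinset_card] at this
    exact_mod_cast this
  let T : Set (Fin n ↪ ℕ) := {i | ∀ j, i j ∈ S}
  let e : T ≃ (Fin n ↪ S) :=
    { toFun := fun i => Function.Embedding.codRestrict S i.1 i.2
      invFun := fun f => ⟨f.trans (Function.Embedding.subtype _), fun j => (f j).2⟩
      left_inv := fun i => by ext; rfl
      right_inv := fun f => by ext; rfl }
  have h1 : ∀ i : Fin n ↪ ℕ, {X : ℕ → Space d | ∀ j, X (i j) ∈ B}.indicator
      (1 : (ℕ → Space d) → ℝ≥0∞) X = T.indicator 1 i := fun i => rfl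
  simp_rw [h1]
  rw [← tsum_subtype]
  simp only [Pi.one_apply]
  rw [← e.symm.tsum_eq, tsum_fintype]
  simp [Fintype.card_embedding_eq, hcard, Nat.descFactorial_self]

/-- A configuration with n points in `B` is enumerated by exactly n! embeddings, and hypothesis `h`
gives the same value of `φ` along each of them. -/
theorem lintegral_tupleMeasure {B : Set (Space d)} (hB : MeasurableSet B) {n : ℕ}
    {Ψ : (ℕ → Space d) → ℝ≥0∞} {φ : (Fin n → Space d) → ℝ≥0∞} (hφ : Measurable φ)
    (h : ∀ X, ∀ i : Fin n ↪ ℕ, Set.range i = {j | X j ∈ B} → Ψ X = φ (X ∘ i)) :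
    ∫⁻ x, φ x ∂(tupleMeasure P B n) = n.factorial * ∫⁻ X in {X | count B X = n}, Ψ X ∂P := by
  have hE := measurableSet_count_eq hB n
  unfold tupleMeasure
  rw [lintegral_sum_measure]
  have h1 : ∀ i : Fin n ↪ ℕ, ∫⁻ x, φ x ∂((P.restrict ({X | count B X = n} ∩
      {X | ∀ j, X (i j) ∈ B})).map fun X => X ∘ i) = ∫⁻ X in {X | count B X = n},
      {X : ℕ → Space d | ∀ j, X (i j) ∈ B}.indicator (fun X => φ (X ∘ i)) X ∂P := by
    intro i
    rw [lintegral_map hφ (measurable_comp_embedding i), Set.inter_comm,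
      ← Measure.restrict_restrict (measurableSet_forall_mem hB i),
      lintegral_indicator (measurableSet_forall_mem hB i)]
  simp_rw [h1]
  rw [← lintegral_tsum (f := fun (i : Fin n ↪ ℕ) X =>
    {X : ℕ → Space d | ∀ j, X (i j) ∈ B}.indicator (fun X => φ (X ∘ i)) X)
    fun i => ((hφ.comp (measurable_comp_embedding i)).indicator
    (measurableSet_forall_mem hB i)).aemeasurable, ← lintegral_const_mul' _ _ (by simp)]
  refine setLIntegral_congr_fun hE fun X hX => ?_
  have h2 : ∀ i : Fin n ↪ ℕ, {X : ℕ → Space d | ∀ j, X (i j) ∈ B}.indicator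
      (fun X => φ (X ∘ i)) X =
      {X : ℕ → Space d | ∀ j, X (i j) ∈ B}.indicator (1 : (ℕ → Space d) → ℝ≥0∞) X * Ψ X := by
    intro i
    by_cases hi : X ∈ {X : ℕ → Space d | ∀ j, X (i j) ∈ B}
    · rw [Set.indicator_of_mem hi, Set.indicator_of_mem hi, h X i (range_eq_of_count_eq hX i hi)]
      simp
    · rw [Set.indicator_of_notMem hi, Set.indicator_of_notMem hi, zero_mul]
  simp only [h2]
  rw [ENNReal.tsum_mul_right, tsum_indicator_embedding hX]

theorem tupleMeasure_pi {B : Set (Space d)} {n : ℕ}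
    {A : Fin n → Set (Space d)} (hA : ∀ j, MeasurableSet (A j)) :
    tupleMeasure P B n (Set.univ.pi A) =
      ∑' i : Fin n ↪ ℕ, P {X | count B X = n ∧ ∀ j, X (i j) ∈ A j ∩ B} := by
  unfold tupleMeasure
  rw [Measure.sum_apply _ (MeasurableSet.univ_pi hA)]
  refine tsum_congr fun i => ?_
  rw [Measure.map_apply (measurable_comp_embedding i) (MeasurableSet.univ_pi hA),
    Measure.restrict_apply (measurable_comp_embedding i (MeasurableSet.univ_pi hA))]
  congr 1
  ext X
  simp only [Set.mem_inter_iff, Set.mem_preimage, Set.mem_univ_pi, Set.mem_ofPred_eq,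
    Function.comp]
  exact ⟨fun ⟨h1, h2, h3⟩ => ⟨h2, fun j => ⟨h1 j, h3 j⟩⟩,
    fun ⟨h1, h2⟩ => ⟨fun j => (h2 j).1, h1, fun j => (h2 j).2⟩⟩

/-- Tuples of distinct points have pairwise disjoint basic neighbourhoods. -/
theorem exists_disjoint_basis {n : ℕ} {x : Fin n → Space d} (hx : x.Injective) :
    ∃ O : Fin n → TopologicalSpace.countableBasis (Space d),
      Pairwise (Function.onFun Disjoint fun j => (O j : Set (Space d))) ∧
      x ∈ Set.univ.pi fun j => (O j : Set (Space d)) := by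
  obtain ⟨s, hs, hd⟩ := Pairwise.exists_mem_filter_of_disjoint (l := fun j => 𝓝 (x j))
    fun a b hab => disjoint_nhds_nhds.2 (hx.ne hab)
  choose O hO hxO hOs using fun j =>
    (TopologicalSpace.isBasis_countableBasis (Space d)).mem_nhds_iff.1 (hs j)
  exact ⟨fun j => ⟨O j, hO j⟩, fun a b hab => (hd hab).mono (hOs a) (hOs b), fun j _ => hxO j⟩

/-- The set is the kernel of a linear map that is nonzero as soon as d > 0, hence a proper subspace.
-/
theorem pi_volume_coincident (hd : 0 < d) {n : ℕ} {a b : Fin n} (hab : a ≠ b) :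
    (volume : Measure (Fin n → Space d)) {x | x a = x b} = 0 := by
  let L : (Fin n → Space d) →ₗ[ℝ] Space d := 
    LinearMap.proj (R := ℝ) (φ := fun _ : Fin n => Space d) a - LinearMap.proj b
  have hset : {x : Fin n → Space d | x a = x b} = (LinearMap.ker L : Set _) := by
    ext x
    simp [L, sub_eq_zero]
  rw [hset]
  refine Measure.addHaar_submodule _ _ fun htop => ?_
  have : Nonempty (Fin d) := ⟨⟨0, hd⟩⟩
  obtain ⟨y, hy⟩ := exists_ne (0 : Space d)
  have h1 : Pi.single a y ∈ LinearMap.ker L := htop ▸ Submodule.mem_top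
  simp [L, hab.symm, hy] at h1

/-- The two measures agree on products of disjoint cells, hence on the union `D` of countably many
such products, which contains every tuple of distinct points. The product measure gives `Dᶜ` mass
zero. Since the total masses coincide, so does `tupleMeasure`; that the points are almost surely
distinct is thus a consequence, not an assumption. -/
theorem IsPoissonProcess.tupleMeasure_eq (hd : 0 < d) (hP : IsPoissonProcess r P)
    {B : Set (Space d)} (hB : MeasurableSet B) (hB' : volume B ≠ ∞) (n : ℕ) :
    tupleMeasure P B n = ENNReal.ofReal (Real.exp (-meanCount r B)) •
      Measure.pi fun _ => r • volume.restrict B := by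
  have : IsFiniteMeasure (volume.restrict B) := ⟨by simpa using hB'.lt_top⟩
  set c := ENNReal.ofReal (Real.exp (-meanCount r B)) with hc
  have hc0 : c ≠ 0 := by simp [hc, Real.exp_pos]
  have hct : c ≠ ∞ := ENNReal.ofReal_ne_top
  set ν : Measure (Fin n → Space d) := Measure.pi fun _ => r • volume.restrict B with hν
  have hrect : ∀ O : Fin n → Set (Space d), (∀ j, MeasurableSet (O j)) →
      Pairwise (Function.onFun Disjoint O) →
      (tupleMeasure P B n).restrict (Set.univ.pi O) = (c • ν).restrict (Set.univ.pi O) := by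
    intro O hO hdis
    -- Dividing by `c` leaves a measure that can be identified as a product measure by its values on
    -- rectangles.
    have : Measure.pi (fun j => (r • volume.restrict B).restrict (O j)) =
        c⁻¹ • (tupleMeasure P B n).restrict (Set.univ.pi O) := by
      refine Measure.pi_eq fun s hs => ?_
      have hA : ∀ j, MeasurableSet (s j ∩ O j ∩ B) := fun j => ((hs j).inter (hO j)).inter hB
      rw [Measure.smul_apply, Measure.restrict_apply (MeasurableSet.univ_pi hs),
        ← Set.pi_inter_distrib, tupleMeasure_pi fun j => (hs j).inter (hO j),
        hP.tsum_tuples_disjoint hB hB' hA (fun _ => Set.inter_subset_right)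
          (fun a b hab => (hdis hab).mono (fun _ h => h.1.2) (fun _ h => h.1.2)),
        smul_eq_mul, ← mul_assoc, ENNReal.inv_mul_cancel hc0 hct, one_mul]
      refine Finset.prod_congr rfl fun j _ => ?_
      rw [Measure.restrict_apply (hs j), Measure.smul_apply,
        Measure.restrict_apply ((hs j).inter (hO j))]
      rfl
    rw [Measure.restrict_smul, hν, Measure.restrict_pi_pi, this, smul_smul,
      ENNReal.mul_inv_cancel hc0 hct, one_smul]
  let ι := {O : Fin n → TopologicalSpace.countableBasis (Space d) //
    Pairwise (Function.onFun Disjoint fun j => (O j : Set (Space d)))}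
  set D : Set (Fin n → Space d) := ⋃ O : ι, Set.univ.pi fun j => (O.1 j : Set (Space d)) with hD
  have hmeas : ∀ b : TopologicalSpace.countableBasis (Space d), MeasurableSet (b : Set (Space d)) :=
    fun b => (TopologicalSpace.isOpen_of_mem_countableBasis b.2).measurableSet
  have hcount : Countable (TopologicalSpace.countableBasis (Space d)) :=
    TopologicalSpace.countable_countableBasis _
  have hres : (tupleMeasure P B n).restrict D = (c • ν).restrict D :=
    Measure.restrict_iUnion_congr.2 fun O => hrect _ (fun j => hmeas _) O.2
  have hDm : MeasurableSet D := MeasurableSet.iUnion fun O => MeasurableSet.univ_pi fun j => hmeas _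
  have hνD : (c • ν) Dᶜ = 0 := by
    have hsub : Dᶜ ⊆ ⋃ a : Fin n, ⋃ b : Fin n, ⋃ _ : a ≠ b, {x | x a = x b} := by
      intro x hx
      by_contra hne
      have hinj : x.Injective := fun a b hab => by
        by_contra h
        exact hne (Set.mem_iUnion.2 ⟨a, Set.mem_iUnion.2 ⟨b, Set.mem_iUnion.2 ⟨h, hab⟩⟩⟩)
      obtain ⟨O, hO, hxO⟩ := exists_disjoint_basis hinj
      exact hx (Set.mem_iUnion.2 ⟨⟨O, hO⟩, hxO⟩)
    have hν' : ν = (r : ℝ≥0∞) ^ n • volume.restrict (Set.univ.pi fun _ => B) := by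
      refine Measure.pi_eq fun s hs => ?_
      rw [Measure.smul_apply, Measure.restrict_apply (MeasurableSet.univ_pi hs),
        ← Set.pi_inter_distrib, volume_pi_pi, smul_eq_mul]
      simp_rw [Measure.smul_apply, Measure.restrict_apply (hs _)]
      simp only [ENNReal.smul_def, smul_eq_mul]
      rw [Finset.prod_mul_distrib]
      simp
    have hle : ν ≪ volume := by
      rw [hν']
      exact Measure.smul_absolutelyContinuous.trans Measure.restrict_le_self.absolutelyContinuous
    have : ν Dᶜ = 0 := hle (measure_mono_null hsub (measure_iUnion_null fun a =>
      measure_iUnion_null fun b => measure_iUnion_null fun h => pi_volume_coincident hd h))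
    simp [this]
  -- With `φ = 1` the total mass is n! times the Poisson probability of n points, and the factorials
  -- cancel.
  have hmass : tupleMeasure P B n Set.univ = (c • ν) Set.univ := by
    have h1 := lintegral_tupleMeasure (P := P) hB (n := n) (Ψ := 1) (φ := 1) measurable_one
      fun _ _ _ => rfl
    simp only [Pi.one_apply, lintegral_one, Measure.restrict_apply_univ] at h1
    rw [h1, hP.measure_count_eq hB hB', Measure.smul_apply, hν, Measure.pi_univ,
      ENNReal.mul_div_cancel (by simp [Nat.factorial_ne_zero]) (by simp)]
    simp
    rfl
  have hfin : IsFiniteMeasure (c • ν) := by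
    have : IsFiniteMeasure ν := by
      rw [hν]; infer_instance
    exact ν.smul_finite hct
  have hD' : tupleMeasure P B n D = (c • ν) D := by
    have := congrArg (fun μ => μ Set.univ) hres
    simpa using this
  have htD : tupleMeasure P B n Dᶜ = 0 := by
    rw [measure_compl hDm (by rw [hD']; exact measure_ne_top _ _), hmass, hD',
      ← measure_compl hDm (measure_ne_top _ _), hνD]
  rw [← Measure.restrict_eq_self_of_ae_mem (s := D) (μ := tupleMeasure P B n) htD, hres,
    Measure.restrict_eq_self_of_ae_mem (s := D) (μ := c • ν) hνD]

/-- Given that there are `n` points of a Poisson process in `B`, they are independent and uniform,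
in the sense that symmetric functionals have the corresponding mean. -/
theorem IsPoissonProcess.setLIntegral_count_eq (hd : 0 < d) (hP : IsPoissonProcess r P)
    {B : Set (Space d)} (hB : MeasurableSet B) (hB' : volume B ≠ ∞) {n : ℕ}
    {Ψ : (ℕ → Space d) → ℝ≥0∞} {φ : (Fin n → Space d) → ℝ≥0∞} (hφ : Measurable φ)
    (h : ∀ X, ∀ i : Fin n ↪ ℕ, Set.range i = {j | X j ∈ B} → Ψ X = φ (X ∘ i)) :
    ∫⁻ X in {X | count B X = n}, Ψ X ∂P =
      ENNReal.ofReal (Real.exp (-meanCount r B)) / n.factorial *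
        ∫⁻ x, φ x ∂(Measure.pi fun _ => r • volume.restrict B) := by
  have h1 := lintegral_tupleMeasure (P := P) hB hφ h
  rw [hP.tupleMeasure_eq hd hB hB', lintegral_smul_measure, smul_eq_mul] at h1
  rw [ENNReal.div_eq_inv_mul, mul_assoc, h1, ← mul_assoc, ENNReal.inv_mul_cancel
    (by simp [Nat.factorial_ne_zero]) (by simp), one_mul]

end Poisson

/-! ### The bounded differences inequality -/

section BoundedDifferences

variable {Ω : Type*} [MeasurableSpace Ω] (μ : Measure Ω) [IsProbabilityMeasure μ]

theorem integrable_of_abs_le {α : Type*} [MeasurableSpace α] {ν : Measure α} [IsFiniteMeasure ν]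
    {f : α → ℝ} (hf : Measurable f) {M : ℝ} (hM : ∀ x, |f x| ≤ M) : Integrable f ν :=
  Integrable.of_bound hf.aestronglyMeasurable M (ae_of_all _ hM)

/-- The exponential moment bound behind the bounded differences inequality. -/
theorem integral_exp_le_of_bounded_differences {c M : ℝ} (t : ℝ) (n : ℕ)
    (f : (Fin n → Ω) → ℝ) (hf : Measurable f) (hM : ∀ x, |f x| ≤ M)
    (hdiff : ∀ x j y, |f x - f (Function.update x j y)| ≤ c) :
    ∫ x, Real.exp (t * f x) ∂(Measure.pi fun _ => μ) ≤
      Real.exp (t * ∫ x, f x ∂(Measure.pi fun _ => μ) + n * (c ^ 2 * t ^ 2 / 2)) := by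
  induction n with
  | zero =>
    have : Measure.pi (fun _ : Fin 0 => μ) = Measure.dirac default := by
      rw [Measure.pi_of_empty]; congr
    rw [this]
    simp
  | succ n ih =>
    set π : Measure (Fin n → Ω) := Measure.pi fun _ => μ with hπ
    have hmp := (measurePreserving_piFinSuccAbove (fun _ : Fin (n + 1) => μ) 0).symm
    have hsymm : ∀ z : Ω × (Fin n → Ω), (MeasurableEquiv.piFinSuccAbove
        (fun _ : Fin (n + 1) => Ω) 0).symm z = (Fin.cons z.1 z.2 : Fin (n + 1) → Ω) := fun z => by
      simp [MeasurableEquiv.piFinSuccAbove_symm_apply, Fin.insertNthEquiv, Fin.insertNth_zero']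
    have hint : ∀ h : (Fin (n + 1) → Ω) → ℝ, Measurable h → (∃ C, ∀ x, |h x| ≤ C) →
        ∫ x, h x ∂(Measure.pi fun _ => μ) = ∫ a, ∫ y, h (Fin.cons a y) ∂π ∂μ := by
      intro h hh ⟨C, hC⟩
      rw [← hmp.map_eq, integral_map_equiv, integral_prod _ ?_]
      · simp only [hsymm]; rfl
      · exact integrable_of_abs_le (hh.comp (MeasurableEquiv.measurable _)) fun x => hC _
    have hcons : Measurable fun z : Ω × (Fin n → Ω) => (Fin.cons z.1 z.2 : Fin (n + 1) → Ω) := by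
      simp_rw [← hsymm]
      exact MeasurableEquiv.measurable _
    have hcons' : ∀ a : Ω, Measurable fun y : Fin n → Ω => (Fin.cons a y : Fin (n + 1) → Ω) :=
      fun a => hcons.comp (measurable_const.prodMk measurable_id)
    -- The first coordinate is split off. The average `F` over the others still oscillates by at
    -- most `c`, and the induction hypothesis applies to each section of `f`.
    set F : Ω → ℝ := fun a => ∫ y, f (Fin.cons a y) ∂π with hF
    have hFm : Measurable F := ((hf.comp hcons).stronglyMeasurable.integral_prod_right').measurable
    have hi : ∀ a, Integrable (fun y => f (Fin.cons a y)) π := fun a =>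
      integrable_of_abs_le (hf.comp (hcons' a)) fun x => hM _
    have hFM : ∀ a, |F a| ≤ M := fun a => by
      have := norm_integral_le_of_norm_le_const (μ := π) (C := M) (f := fun y => f (Fin.cons a y))
        (ae_of_all _ fun y => hM (Fin.cons a y))
      simpa using this
    have hexpM : ∀ u : ℝ, |u| ≤ M → |Real.exp (t * u)| ≤ Real.exp (|t| * M) := fun u hu => by
      rw [Real.abs_exp]
      refine Real.exp_le_exp.2 ((le_abs_self _).trans ?_)
      rw [abs_mul]
      gcongr
    have hexpm : Measurable fun x => Real.exp (t * f x) := by fun_prop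
    have hFdiff : ∀ a b, |F a - F b| ≤ c := fun a b => by
      rw [hF]
      simp only
      rw [← integral_sub (hi a) (hi b)]
      have := norm_integral_le_of_norm_le_const (μ := π) (C := c)
        (f := fun y => f (Fin.cons a y) - f (Fin.cons b y)) (ae_of_all _ fun y => by
          have := hdiff (Fin.cons a y) 0 b
          rwa [Fin.update_cons_zero] at this)
      simpa using this
    have h1 : ∀ a, ∫ y, Real.exp (t * f (Fin.cons a y)) ∂π ≤
        Real.exp (n * (c ^ 2 * t ^ 2 / 2)) * Real.exp (t * F a) := fun a => by
      rw [← Real.exp_add, add_comm (_ * (_ / _))]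
      refine ih _ (hf.comp (hcons' a)) (fun x => hM _) fun x j y => ?_
      have := hdiff (Fin.cons a x) j.succ y
      rwa [← Fin.cons_update] at this
    obtain ⟨a₀⟩ := nonempty_of_isProbabilityMeasure μ
    -- An interval of length 2c centred at one value of `F` gives Hoeffding's lemma with variance
    -- proxy c²; the sharper c²/4 is not needed.
    have hsub := hasSubgaussianMGF_of_mem_Icc (μ := μ) (a := F a₀ - c) (b := F a₀ + c)
      hFm.aemeasurable (ae_of_all _ fun a => by
        have := abs_le.1 (hFdiff a a₀)
        exact ⟨by linarith, by linarith⟩)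
    have h2 : ∫ a, Real.exp (t * F a) ∂μ ≤ Real.exp (t * ∫ a, F a ∂μ + c ^ 2 * t ^ 2 / 2) := by
      have h3 := hsub.mgf_le t
      have h4 : mgf (fun a => F a - ∫ a, F a ∂μ) μ t =
          Real.exp (-(t * ∫ a, F a ∂μ)) * ∫ a, Real.exp (t * F a) ∂μ := by
        rw [mgf, ← integral_const_mul]
        refine integral_congr_ae (ae_of_all _ fun a => ?_)
        simp only
        rw [← Real.exp_add]
        ring_nf
      rw [h4] at h3
      have h5 : (((‖F a₀ + c - (F a₀ - c)‖₊ / 2) ^ 2 : ℝ≥0) : ℝ) = c ^ 2 := by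
        push_cast
        rw [Real.norm_eq_abs, div_pow, sq_abs]
        ring
      rw [h5] at h3
      rw [Real.exp_add]
      calc _ = Real.exp (t * ∫ a, F a ∂μ) *
            (Real.exp (-(t * ∫ a, F a ∂μ)) * ∫ a, Real.exp (t * F a) ∂μ) := by
            rw [← mul_assoc, ← Real.exp_add, add_neg_cancel, Real.exp_zero, one_mul]
        _ ≤ _ := by gcongr
    rw [hint _ hexpm ⟨_, fun x => hexpM _ (hM x)⟩, hint f hf ⟨M, hM⟩]
    calc _ ≤ ∫ a, Real.exp (n * (c ^ 2 * t ^ 2 / 2)) * Real.exp (t * F a) ∂μ := by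
          refine integral_mono ?_ ?_ h1
          · refine integrable_of_abs_le (M := Real.exp (|t| * M))
              ((hexpm.comp hcons).stronglyMeasurable.integral_prod_right').measurable fun a => ?_
            have := norm_integral_le_of_norm_le_const (μ := π) (C := Real.exp (|t| * M))
              (f := fun y => Real.exp (t * f (Fin.cons a y)))
              (ae_of_all _ fun y => hexpM _ (hM (Fin.cons a y)))
            simpa using this
          · exact (integrable_of_abs_le (by fun_prop) fun a => hexpM _ (hFM a)).const_mul _
      _ ≤ Real.exp (n * (c ^ 2 * t ^ 2 / 2)) *
            Real.exp (t * ∫ a, F a ∂μ + c ^ 2 * t ^ 2 / 2) := by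
          rw [integral_const_mul]
          gcongr
      _ = _ := by
          rw [← Real.exp_add]
          congr 1
          push_cast
          ring

/-- The bounded differences inequality. -/
theorem measureReal_ge_le_of_bounded_differences {ι : Type*} [Fintype ι] [DecidableEq ι]
    {c M : ℝ} (hc : 0 < c)
    (f : (ι → Ω) → ℝ) (hf : Measurable f) (hM : ∀ x, |f x| ≤ M)
    (hdiff : ∀ x j y, |f x - f (Function.update x j y)| ≤ c) {δ : ℝ} (hδ : 0 ≤ δ) :
    (Measure.pi fun _ => μ).real {x | ∫ x, f x ∂(Measure.pi fun _ => μ) + δ ≤ f x} ≤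
      Real.exp (-(δ ^ 2 / (2 * Fintype.card ι * c ^ 2))) := by
  set n := Fintype.card ι with hn
  let e : Fin n ≃ ι := (Fintype.equivFin ι).symm
  have hmp := measurePreserving_piCongrLeft (fun _ : ι => μ) e
  set f' : (Fin n → Ω) → ℝ := fun x => f (fun i => x (e.symm i)) with hf'
  have hee : ∀ x : Fin n → Ω, MeasurableEquiv.piCongrLeft (fun _ : ι => Ω) e x =
      fun i => x (e.symm i) := fun x => by
    ext i
    obtain ⟨k, rfl⟩ := e.surjective i
    rw [MeasurableEquiv.coe_piCongrLeft, Equiv.piCongrLeft_apply_apply, e.symm_apply_apply]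
  have hint : ∀ t : ℝ, ∫ x, Real.exp (t * f x) ∂(Measure.pi fun _ => μ) ≤
      Real.exp (t * ∫ x, f x ∂(Measure.pi fun _ => μ) + n * (c ^ 2 * t ^ 2 / 2)) := by
    intro t
    have h := integral_exp_le_of_bounded_differences μ t n f' (by fun_prop) (fun x => hM _)
      fun x j y => by
        have := hdiff (fun i => x (e.symm i)) (e j) y
        have hu : Function.update (fun i => x (e.symm i)) (e j) y =
            fun i => Function.update x j y (e.symm i) := by
          ext i
          simp [Function.update_apply, Equiv.symm_apply_eq]
        rw [hu] at this
        exact this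
    rw [← hmp.map_eq, integral_map_equiv, integral_map_equiv]
    simp only [hee]
    exact h
  set E := ∫ x, f x ∂(Measure.pi fun _ => μ) with hE
  -- For n = 0 division by zero makes the claimed bound equal to 1.
  rcases Nat.eq_zero_or_pos n with h0 | h0
  · rw [h0]; simp
  have hn' : (0 : ℝ) < n := by exact_mod_cast h0
  -- The minimiser of the Chernoff exponent n c² t²/2 - tδ.
  set t : ℝ := δ / (n * c ^ 2) with ht
  have ht0 : 0 ≤ t := by positivity
  have hcher := measure_ge_le_exp_mul_mgf (μ := Measure.pi fun _ : ι => μ) (X := f) (E + δ) ht0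
    (integrable_of_abs_le (M := Real.exp (|t| * M)) (by fun_prop) fun x => by
      rw [Real.abs_exp]
      refine Real.exp_le_exp.2 ((le_abs_self _).trans ?_)
      rw [abs_mul]
      gcongr
      exact hM x)
  refine hcher.trans ?_
  calc _ ≤ Real.exp (-t * (E + δ)) * Real.exp (t * E + n * (c ^ 2 * t ^ 2 / 2)) := by
        gcongr
        exact hint t
    _ = _ := by
        rw [← Real.exp_add]
        congr 1
        rw [ht]
        field_simp
        ring

end BoundedDifferences

/-! ### Measurability of the random graph -/

section Measurability

/-- Along a ray `g` is antitone, hence measurable, and `g` is this function composed with the norm.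
A unit vector exists because d > 0. -/
theorem ConnectionFunction.measurable {d : ℕ} (hd : 0 < d) (g : ConnectionFunction d) :
    Measurable g.toFun := by
  have : Nonempty (Fin d) := ⟨⟨0, hd⟩⟩
  obtain ⟨e, he⟩ := exists_norm_eq (Space d) zero_le_one
  have hanti : Antitone fun s : ℝ => g.toFun (max s 0 • e) := fun s t hst => by
    refine g.anti _ _ ?_
    simp only [norm_smul, he, mul_one, Real.norm_eq_abs]
    rw [abs_of_nonneg (le_max_right _ _), abs_of_nonneg (le_max_right _ _)]
    exact max_le_max_right 0 hst
  have heq : g.toFun = (fun s : ℝ => g.toFun (max s 0 • e)) ∘ norm := by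
    ext x
    have hnorm : ‖max ‖x‖ 0 • e‖ = ‖x‖ := by
      rw [max_eq_left (norm_nonneg x), norm_smul, he, norm_norm, mul_one]
    exact le_antisymm (g.anti _ _ hnorm.le) (g.anti _ _ hnorm.ge)
  rw [heq]
  exact hanti.measurable.comp measurable_norm

/-- A finite vertex set carries finitely many graphs, so once each graph has a measurable level set,
`f` may be arbitrary. -/
theorem measurable_connGraph_comp {d : ℕ} (hd : 0 < d) (g : ConnectionFunction d)
    {α β V : Type*} [MeasurableSpace α] [MeasurableSpace β] [Finite V]
    {y : α → V → Space d} {U : α → Sym2 V → I} (hy : Measurable y) (hU : Measurable U)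
    (f : SimpleGraph V → β) : Measurable fun a => f (connGraph g (y a) (U a)) := by
  have hadj : ∀ G : SimpleGraph V, MeasurableSet {a | connGraph g (y a) (U a) = G} := by
    intro G
    have : {a | connGraph g (y a) (U a) = G} =
        ⋂ v, ⋂ w, {a | (v ≠ w ∧ (U a s(v, w) : ℝ) ≤ g.toFun (y a v - y a w)) ↔ G.Adj v w} := by
      ext a
      simp only [Set.mem_ofPred_eq, SimpleGraph.ext_iff, funext_iff, Set.mem_iInter, eq_iff_iff]
      rfl
    rw [this]
    have hgm := g.measurable hd
    refine MeasurableSet.iInter fun v => MeasurableSet.iInter fun w => ?_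
    have hle : MeasurableSet {a | (U a s(v, w) : ℝ) ≤ g.toFun (y a v - y a w)} :=
      measurableSet_le (by fun_prop) (by fun_prop)
    by_cases hvw : v = w <;> by_cases hG : G.Adj v w
    · simp [hvw]
    · simp [hvw]
    · simpa [hvw, hG] using hle
    · simp only [hvw, hG, ne_eq, not_false_eq_true, true_and, iff_false]
      exact hle.compl
  intro s _
  have : (fun a => f (connGraph g (y a) (U a))) ⁻¹' s =
      ⋃ G ∈ {G | f G ∈ s}, {a | connGraph g (y a) (U a) = G} := by
    ext a
    simp
  rw [this]
  exact MeasurableSet.biUnion (Set.to_countable _) fun G _ => hadj G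

theorem measurable_rooted {d n : ℕ} :
    Measurable fun z : Space d × (Fin n → Space d) => rooted z.1 z.2 := by
  refine measurable_pi_lambda _ fun v => ?_
  cases v with
  | none => exact measurable_fst
  | some j => exact (measurable_pi_apply j).comp measurable_snd

end Measurability

/-! ### Influence of a single point -/

section SiteGreenBounds

variable {n : ℕ} {p q : ℝ}

theorem one_sub_pow_mem (hq : 0 ≤ q) (hq' : q ≤ 1) (k : ℕ) :
    0 ≤ 1 - (1 - q) ^ k ∧ 1 - (1 - q) ^ k ≤ 1 := by
  have h1 : (1 - q) ^ k ≤ 1 := pow_le_one₀ (by linarith) (by linarith)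
  have h2 : 0 ≤ (1 - q) ^ k := pow_nonneg (by linarith) k
  exact ⟨by linarith, by linarith⟩

theorem sum_siteWeight (p : ℝ) (n : ℕ) :
    ∑ s : Finset (Fin n), p ^ s.card * (1 - p) ^ (n - s.card) = 1 := by
  have := Fin.sum_pow_mul_eq_add_pow p (1 - p) (n := n)
  simpa using this

/-- This is the probability that `j` belongs to ω. It is obtained by expanding the product of the
factors p + (1 - p) in which the term 1 - p of factor `j` is replaced by 0. -/
theorem sum_siteWeight_mem (p : ℝ) (j : Fin n) :
    ∑ s : Finset (Fin n), (if j ∈ s then p ^ s.card * (1 - p) ^ (n - s.card) else 0) = p := by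
  have h := Finset.prod_add (fun _ : Fin n => p) (fun i => if i = j then 0 else 1 - p) Finset.univ
  have h1 : ∏ i : Fin n, (p + if i = j then 0 else 1 - p) = p := by
    rw [Finset.prod_eq_single j (fun i _ hi => by simp [hi]) (by simp)]
    simp
  rw [h1, Finset.powerset_univ] at h
  refine Eq.trans ?_ h.symm
  refine Finset.sum_congr rfl fun s _ => ?_
  split_ifs with hj
  · rw [Finset.prod_const]
    congr 1
    rw [Finset.prod_congr rfl (g := fun _ => 1 - p), Finset.prod_const,
      ← Finset.compl_eq_univ_sdiff, Finset.card_compl, Fintype.card_fin]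
    intro i hi
    rw [if_neg]
    rintro rfl
    exact (Finset.mem_sdiff.1 hi).2 hj
  · rw [Finset.prod_eq_zero (i := j) (s := Finset.univ \ s), mul_zero]
    · simp [hj]
    · simp

theorem siteGreen_mem_Icc (hp : 0 ≤ p) (hp' : p ≤ 1) (hq : 0 ≤ q) (hq' : q ≤ 1)
    (G : SimpleGraph (Option (Fin n))) (v : Option (Fin n)) :
    0 ≤ siteGreen p q G v ∧ siteGreen p q G v ≤ 1 := by
  have hw : ∀ s : Finset (Fin n), 0 ≤ p ^ s.card * (1 - p) ^ (n - s.card) := fun s =>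
    mul_nonneg (pow_nonneg hp _) (pow_nonneg (by linarith) _)
  constructor
  · exact Finset.sum_nonneg fun s _ => mul_nonneg (hw s) (one_sub_pow_mem hq hq' _).1
  · rw [← sum_siteWeight p n]
    exact Finset.sum_le_sum fun s _ => mul_le_of_le_one_right (hw s) (one_sub_pow_mem hq hq' _).2

/-- Only the sets `s` containing `j` see the change, and their total weight is `p`. -/
theorem abs_siteGreen_sub_le (hp : 0 ≤ p) (hp' : p ≤ 1) (hq : 0 ≤ q) (hq' : q ≤ 1)
    {G H : SimpleGraph (Option (Fin n))} (j : Fin n)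
    (h : ∀ a b, a ≠ some j → b ≠ some j → (G.Adj a b ↔ H.Adj a b)) :
    |siteGreen p q G none - siteGreen p q H none| ≤ p := by
  have hw : ∀ s : Finset (Fin n), 0 ≤ p ^ s.card * (1 - p) ^ (n - s.card) := fun s =>
    mul_nonneg (pow_nonneg hp _) (pow_nonneg (by linarith) _)
  unfold siteGreen
  rw [← Finset.sum_sub_distrib]
  refine (Finset.abs_sum_le_sum_abs _ _).trans
    ((Finset.sum_le_sum fun s _ => ?_).trans (sum_siteWeight_mem p j).le)
  rw [← mul_sub, abs_mul, abs_of_nonneg (hw s)]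
  split_ifs with hj
  · refine mul_le_of_le_one_right (hw s) (abs_le.2 ?_)
    have h1 := one_sub_pow_mem hq hq' (cluster G (some '' (s : Set (Fin n))) none).ncard
    have h2 := one_sub_pow_mem hq hq' (cluster H (some '' (s : Set (Fin n))) none).ncard
    constructor <;> linarith
  · have hne : ∀ a ∈ insert none (some '' (s : Set (Fin n))), a ≠ some j := by
      rintro _ (rfl | ⟨i, hi, rfl⟩)
      · simp
      · rintro h'
        exact hj ((Option.some_injective _ h') ▸ hi)
    rw [cluster_congr rfl fun a ha b hb => h a b (hne a ha) (hne b hb)]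
    simp

end SiteGreenBounds

/-! ### Independent vertex data and concentration -/

section EdgeLaw

theorem infinitePi_map_comp_injective {ι κ Ω : Type*} [MeasurableSpace Ω] (μ : Measure Ω)
    [IsProbabilityMeasure μ] {e : ι → κ} (he : e.Injective) :
    (Measure.infinitePi fun _ : κ => μ).map (fun u => u ∘ e) = Measure.infinitePi fun _ : ι => μ := by
  classical
  have hm : Measurable fun (u : κ → Ω) => u ∘ e :=
    measurable_pi_lambda _ fun i => measurable_pi_apply (e i)
  refine Measure.eq_infinitePi _ fun s t ht => ?_
  rw [Measure.map_apply hm (MeasurableSet.pi s.countable_toSet fun i _ => ht i)]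
  have : (fun u : κ → Ω => u ∘ e) ⁻¹' (Set.pi s t) =
      Set.pi (s.map ⟨e, he⟩ : Finset κ) (Function.extend e t fun _ => Set.univ) := by
    ext u
    simp [Set.mem_pi, he.extend_apply]
  rw [this, Measure.infinitePi_pi]
  · simp [he.extend_apply]
  · intro k hk
    obtain ⟨i, _, rfl⟩ := Finset.mem_map.1 hk
    simp [he.extend_apply, ht]

/-- The law of independent uniform variables attached to the unordered pairs. -/
noncomputable def edgeLaw (V : Type*) : Measure (Sym2 V → I) :=
  Measure.infinitePi fun _ : Sym2 V => (volume : Measure I)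

instance (V : Type*) : IsProbabilityMeasure (edgeLaw V) := by unfold edgeLaw; infer_instance

theorem measurePreserving_edgeLaw {V W : Type*} {f : V → W} (hf : f.Injective) :
    MeasurePreserving (fun U : Sym2 W → I => U ∘ Sym2.map f) (edgeLaw W) (edgeLaw V) :=
  ⟨measurable_pi_lambda _ fun _ => measurable_pi_apply _,
    infinitePi_map_comp_injective _ (Sym2.map.injective hf)⟩

/-- The law of `n` independent points with law `ν` and of the edge variables between them and
a root. -/
noncomputable def modelLaw {d : ℕ} (ν : Measure (Space d)) (n : ℕ) :
    Measure ((Fin n → Space d) × (Sym2 (Option (Fin n)) → I)) :=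
  (Measure.pi fun _ => ν).prod (edgeLaw _)

instance {d : ℕ} (ν : Measure (Space d)) [IsProbabilityMeasure ν] (n : ℕ) :
    IsProbabilityMeasure (modelLaw ν n) := by unfold modelLaw; infer_instance

/-- Every pair of vertices ordered so that the root comes last. -/
def owner {n : ℕ} (s : Sym2 (Option (Fin n))) : Option (Fin n) × Option (Fin n) :=
  let rank : Option (Fin n) → ℕ := fun v => v.elim 0 fun j => j + 1
  s.lift ⟨fun a b => if rank a < rank b then (b, a) else (a, b), fun a b => by
    have hinj : rank.Injective := by
      rintro (_ | a) (_ | b) h <;> simp [rank, Fin.ext_iff] at h ⊢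
      exact h
    rcases lt_trichotomy (rank a) (rank b) with h | h | h
    · simp only [h, if_true, h.not_gt, if_false]
    · simp [hinj h]
    · simp only [h, if_true, h.not_gt, if_false]⟩

theorem mk_owner {n : ℕ} (s : Sym2 (Option (Fin n))) : s((owner s).1, (owner s).2) = s := by
  induction s with
  | _ a b =>
    simp only [owner, Sym2.lift_mk]
    split_ifs
    · exact Sym2.eq_swap
    · rfl

theorem owner_injective {n : ℕ} : (owner : Sym2 (Option (Fin n)) → _).Injective := fun s t h => by
  rw [← mk_owner s, ← mk_owner t, h]

theorem owner_fst_eq {n : ℕ} (a b : Option (Fin n)) :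
    (owner s(a, b)).1 = a ∨ (owner s(a, b)).1 = b := by
  simp only [owner, Sym2.lift_mk]
  split_ifs <;> simp

theorem owner_fst_ne_none {n : ℕ} {a b : Option (Fin n)} (hab : a ≠ b) :
    (owner s(a, b)).1 ≠ none := by
  simp only [owner, Sym2.lift_mk]
  cases a <;> cases b <;> simp at hab ⊢
  split_ifs <;> simp

/-- The model obtained from independent data attached to the vertices: a position, and the
variables of the edges to the vertices of lower rank. -/
def assemble {d n : ℕ} (Y : Option (Fin n) → Space d × (Option (Fin n) → I)) :
    (Fin n → Space d) × (Sym2 (Option (Fin n)) → I) :=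
  (fun j => (Y (some j)).1, fun s => (Y (owner s).1).2 (owner s).2)

/-- Off the diagonal a pair is owned by its endpoint of higher rank. The data at `v` therefore
influence only edges at `v`, and the data at the root influence no edge. -/
theorem connGraph_assemble_update {d n : ℕ} (g : ConnectionFunction d) (z : Space d)
    (Y : Option (Fin n) → Space d × (Option (Fin n) → I)) {v a b : Option (Fin n)}
    (y : Space d × (Option (Fin n) → I)) (h : v = none ∨ a ≠ v ∧ b ≠ v) :
    (connGraph g (rooted z (assemble Y).1) (assemble Y).2).Adj a b ↔
      (connGraph g (rooted z (assemble (Function.update Y v y)).1)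
        (assemble (Function.update Y v y)).2).Adj a b := by
  by_cases hab : a = b
  · simp [hab]
  have hpos : ∀ w, (v = none ∨ w ≠ v) → rooted z (assemble (Function.update Y v y)).1 w =
      rooted z (assemble Y).1 w := by
    rintro (_ | w) hw
    · rfl
    · have : some w ≠ v := by
        rcases hw with rfl | hw
        · simp
        · exact hw
      simp [rooted, assemble, this]
  have hown : (owner s(a, b)).1 ≠ v := by
    rcases h with rfl | ⟨ha, hb⟩
    · exact owner_fst_ne_none hab
    · rcases owner_fst_eq a b with h | h <;> rw [h] <;> assumption
  simp only [connGraph, hpos a (h.imp_right And.left), hpos b (h.imp_right And.right)]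
  simp [assemble, hown]

/-- Each vertex carries more edge variables than it owns; `owner` selects one for every pair
injectively, so those kept are independent and uniform. -/
theorem measurePreserving_assemble {d n : ℕ} (ν : Measure (Space d)) [IsProbabilityMeasure ν] :
    MeasurePreserving assemble
      (Measure.pi fun _ : Option (Fin n) => ν.prod (Measure.pi fun _ : Option (Fin n) => volume))
      (modelLaw ν n) := by
  have h1 := measurePreserving_arrowProdEquivProdArrow (Space d) (Option (Fin n) → I)
    (Option (Fin n)) (fun _ => ν) (fun _ => Measure.pi fun _ : Option (Fin n) => volume)
  have h2 : MeasurePreserving (fun x : Option (Fin n) → Space d => x ∘ some)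
      (Measure.pi fun _ => ν) (Measure.pi fun _ => ν) := by
    refine ⟨measurable_pi_lambda _ fun _ => measurable_pi_apply _, ?_⟩
    rw [← Measure.infinitePi_eq_pi, ← Measure.infinitePi_eq_pi]
    exact infinitePi_map_comp_injective _ (Option.some_injective _)
  have h3 : MeasurePreserving (MeasurableEquiv.curry (Option (Fin n)) (Option (Fin n)) I).symm
      (Measure.pi fun _ => Measure.pi fun _ => volume) (Measure.infinitePi fun _ => volume) := by
    refine ⟨MeasurableEquiv.measurable _, ?_⟩
    simp_rw [← Measure.infinitePi_eq_pi]
    exact Measure.infinitePi_map_curry_symm fun _ _ => volume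
  have h4 : MeasurePreserving (fun u : Option (Fin n) × Option (Fin n) → I => u ∘ owner)
      (Measure.infinitePi fun _ => volume) (edgeLaw (Option (Fin n))) :=
    ⟨measurable_pi_lambda _ fun _ => measurable_pi_apply _,
      infinitePi_map_comp_injective _ owner_injective⟩
  exact (h2.prod (h4.comp h3)).comp h1

theorem modelLaw_real_ge_le {d : ℕ} (hd : 0 < d) (g : ConnectionFunction d)
    (ν : Measure (Space d)) [IsProbabilityMeasure ν] {p q : ℝ} (hp : 0 < p) (hp' : p ≤ 1)
    (hq : 0 ≤ q) (hq' : q ≤ 1) (n : ℕ) (z : Space d) {δ : ℝ} (hδ : 0 ≤ δ) :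
    (modelLaw ν n).real {c | ∫ c, siteGreen p q (connGraph g (rooted z c.1) c.2) none
        ∂(modelLaw ν n) + δ ≤ siteGreen p q (connGraph g (rooted z c.1) c.2) none} ≤
      Real.exp (-(δ ^ 2 / (2 * (n + 1) * p ^ 2))) := by
  have hfm : Measurable fun c : (Fin n → Space d) × (Sym2 (Option (Fin n)) → I) =>
      siteGreen p q (connGraph g (rooted z c.1) c.2) none :=
    measurable_connGraph_comp hd g (measurable_rooted.comp (measurable_const.prodMk measurable_fst))
      measurable_snd fun G => siteGreen p q G none
  have hT := measurePreserving_assemble (n := n) ν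
  -- There are n + 1 coordinates, the inert one of the root included, each with influence at most
  -- `p`.
  have h := measureReal_ge_le_of_bounded_differences
    (ν.prod (Measure.pi fun _ : Option (Fin n) => (volume : Measure I))) (M := 1) hp
    (fun Y => siteGreen p q (connGraph g (rooted z (assemble Y).1) (assemble Y).2) none)
    (hfm.comp hT.measurable)
    (fun Y => by
      have := siteGreen_mem_Icc hp.le hp' hq hq' (connGraph g (rooted z (assemble Y).1)
        (assemble Y).2) none
      rw [abs_of_nonneg this.1]
      exact this.2)
    (fun Y v y => by
      cases v with
      | none =>
        have : connGraph g (rooted z (assemble Y).1) (assemble Y).2 =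
            connGraph g (rooted z (assemble (Function.update Y none y)).1)
              (assemble (Function.update Y none y)).2 := by
          ext a b
          exact connGraph_assemble_update g z Y y (Or.inl rfl)
        rw [this, sub_self, abs_zero]
        exact hp.le
      | some j =>
        exact abs_siteGreen_sub_le hp.le hp' hq hq' j fun a b ha hb =>
          connGraph_assemble_update g z Y y (Or.inr ⟨ha, hb⟩)) hδ
  rw [← hT.map_eq, integral_map hT.measurable.aemeasurable hfm.aestronglyMeasurable,
    map_measureReal_apply hT.measurable (measurableSet_le measurable_const hfm)]
  simpa using h

end EdgeLaw

/-! ### The averaged probability: binomial against Poisson -/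

section Mean

/-- Comparison of a binomial with a Poisson expectation. -/
theorem sum_binomial_le_of_sum_poisson_le {a : ℕ → ℝ} (ha : ∀ k, 0 ≤ a k) (ha' : ∀ k, a k ≤ 1)
    {m μ b w p : ℝ} {n : ℕ} (hm : ∀ M, ∑ k ∈ Finset.range M,
      Real.exp (-μ) * μ ^ k / k.factorial * a k ≤ m)
    (hμ : 0 ≤ μ) (hbμ : b ≤ μ) (hμw : μ ≤ w) (hb : b ≤ n * p) (hw : n * p * Real.exp p ≤ w)
    (hp : 0 ≤ p) (hp' : p ≤ 1) :
    ∑ k ∈ Finset.range (n + 1), (n.choose k : ℝ) * (p ^ k * (1 - p) ^ (n - k) * a k) ≤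
      m + (Real.exp (w - b) - 1) := by
  have hterm : ∀ k ∈ Finset.range (n + 1),
      (n.choose k : ℝ) * (p ^ k * (1 - p) ^ (n - k) * a k) ≤
        Real.exp (-b) * w ^ k / k.factorial * a k := by
    intro k hk
    have hkn : k ≤ n := Nat.lt_succ_iff.1 (Finset.mem_range.1 hk)
    have h1 : (n.choose k : ℝ) ≤ (n : ℝ) ^ k / k.factorial := Nat.choose_le_pow_div k n
    -- From 1 - p ≤ exp(-p). The surplus exp(pk) goes into the k-th power, which is why `hw`
    -- compares `w` with n p exp(p).
    have h2 : (1 - p) ^ (n - k) ≤ Real.exp (-b) * Real.exp p ^ k := by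
      calc (1 - p) ^ (n - k) ≤ Real.exp (-p) ^ (n - k) := by
            gcongr
            have := Real.add_one_le_exp (-p)
            linarith
        _ = Real.exp (-(n * p)) * Real.exp p ^ k := by
            rw [← Real.exp_nat_mul, ← Real.exp_nat_mul, ← Real.exp_add, Nat.cast_sub hkn]
            ring_nf
        _ ≤ _ := by gcongr
    calc (n.choose k : ℝ) * (p ^ k * (1 - p) ^ (n - k) * a k)
        ≤ (n : ℝ) ^ k / k.factorial * (p ^ k * (Real.exp (-b) * Real.exp p ^ k) * a k) := by
          have := ha k
          gcongr
      _ = Real.exp (-b) * (n * p * Real.exp p) ^ k / k.factorial * a k := by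
          rw [mul_pow, mul_pow]; ring
      _ ≤ _ := by
          have := ha k
          gcongr
  refine (Finset.sum_le_sum hterm).trans ?_
  -- The excess of the majorant over the Poisson weight. It is nonnegative as b ≤ μ ≤ w, and its
  -- total is exp(w - b) - 1.
  set D : ℕ → ℝ := fun k => Real.exp (-b) * w ^ k / k.factorial -
    Real.exp (-μ) * μ ^ k / k.factorial with hD
  have hD0 : ∀ k, 0 ≤ D k := fun k => by
    rw [hD]
    simp only [sub_nonneg]
    gcongr
  have hsum : HasSum D (Real.exp (w - b) - 1) := by
    have h1 : ∀ x : ℝ, HasSum (fun k : ℕ => x ^ k / k.factorial) (Real.exp x) := fun x => by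
      rw [Real.exp_eq_exp_ℝ]
      exact NormedSpace.expSeries_div_hasSum_exp x
    have h2 := ((h1 w).mul_left (Real.exp (-b))).sub ((h1 μ).mul_left (Real.exp (-μ)))
    rw [← Real.exp_add, ← Real.exp_add, neg_add_cancel, Real.exp_zero, add_comm, ← sub_eq_add_neg]
      at h2
    simpa only [hD, mul_div_assoc] using h2
  calc ∑ k ∈ Finset.range (n + 1), Real.exp (-b) * w ^ k / k.factorial * a k
      = ∑ k ∈ Finset.range (n + 1), Real.exp (-μ) * μ ^ k / k.factorial * a k +
        ∑ k ∈ Finset.range (n + 1), D k * a k := by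
        rw [← Finset.sum_add_distrib]
        exact Finset.sum_congr rfl fun k _ => by rw [hD]; ring
    _ ≤ m + ∑ k ∈ Finset.range (n + 1), D k := by
        gcongr with k
        · exact hm _
        · exact mul_le_of_le_one_right (hD0 k) (ha' k)
    _ ≤ _ := by
        gcongr
        exact sum_le_hasSum _ (fun k _ => hD0 k) hsum

/-- The conditional probability, given the graph, that the component of the root contains a green
vertex. -/
noncomputable def fullGreen {n : ℕ} (q : ℝ) (G : SimpleGraph (Option (Fin n))) : ℝ :=
  1 - (1 - q) ^ (cluster G (some '' Set.univ) none).ncard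

/-- The probability that the component of a root at `z` contains a green vertex, in the model with
`k` independent points with law `ν`. -/
noncomputable def annealedGreen {d : ℕ} (g : ConnectionFunction d) (q : ℝ) (ν : Measure (Space d))
    (z : Space d) (k : ℕ) : ℝ :=
  ∫ c, fullGreen q (connGraph g (rooted z c.1) c.2) ∂(modelLaw ν k)

theorem measurable_fullGreen {d n : ℕ} (hd : 0 < d) (g : ConnectionFunction d) (q : ℝ)
    (z : Space d) : Measurable fun c : (Fin n → Space d) × (Sym2 (Option (Fin n)) → I) =>
      fullGreen q (connGraph g (rooted z c.1) c.2) :=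
  measurable_connGraph_comp hd g (measurable_rooted.comp (measurable_const.prodMk measurable_fst))
    measurable_snd _

variable {d : ℕ} (ν : Measure (Space d)) [IsProbabilityMeasure ν]

theorem annealedGreen_mem_Icc (g : ConnectionFunction d) {q : ℝ} (hq : 0 ≤ q)
    (hq' : q ≤ 1) (z : Space d) (k : ℕ) :
    0 ≤ annealedGreen g q ν z k ∧ annealedGreen g q ν z k ≤ 1 := by
  constructor
  · exact integral_nonneg fun c => (one_sub_pow_mem hq hq' _).1
  · refine (integral_mono_of_nonneg (ae_of_all _ fun c => (one_sub_pow_mem hq hq' _).1)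
      (integrable_const (1 : ℝ)) (ae_of_all _ fun c => (one_sub_pow_mem hq hq' _).2)).trans ?_
    simp

theorem measurePreserving_modelLaw {k n : ℕ} (e : Fin k ↪ Fin n) :
    MeasurePreserving (fun c : (Fin n → Space d) × (Sym2 (Option (Fin n)) → I) =>
      (c.1 ∘ e, c.2 ∘ Sym2.map (Option.map e))) (modelLaw ν n) (modelLaw ν k) := by
  have h1 : MeasurePreserving (fun x : Fin n → Space d => x ∘ e)
      (Measure.pi fun _ => ν) (Measure.pi fun _ => ν) := by
    refine ⟨measurable_pi_lambda _ fun _ => measurable_pi_apply _, ?_⟩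
    rw [← Measure.infinitePi_eq_pi, ← Measure.infinitePi_eq_pi]
    exact infinitePi_map_comp_injective _ e.injective
  exact h1.prod (measurePreserving_edgeLaw (Option.map_injective e.injective))

theorem rooted_comp_map {k n : ℕ} (z : Space d) (x : Fin n → Space d) (e : Fin k → Fin n) :
    rooted z x ∘ Option.map e = rooted z (x ∘ e) := by
  ext v : 1
  cases v <;> rfl

theorem integral_cluster_eq_annealedGreen (hd : 0 < d) (g : ConnectionFunction d) (q : ℝ)
    (z : Space d) {n : ℕ} (s : Finset (Fin n)) :
    ∫ c, (1 - (1 - q) ^ (cluster (connGraph g (rooted z c.1) c.2)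
      (some '' (s : Set (Fin n))) none).ncard) ∂(modelLaw ν n) = annealedGreen g q ν z s.card := by
  set e : Fin s.card ↪ Fin n := (s.orderEmbOfFin rfl).toEmbedding with he
  have hinj := Option.map_injective e.injective
  have hs : some '' (s : Set (Fin n)) = Option.map e '' (some '' (Set.univ : Set (Fin s.card))) := by
    have : (s : Set (Fin n)) = Set.range e := (Finset.range_orderEmbOfFin s rfl).symm
    rw [this, ← Set.image_univ]
    ext v
    simp
  have hT := measurePreserving_modelLaw ν e
  have h1 : ∀ c : (Fin n → Space d) × (Sym2 (Option (Fin n)) → I),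
      (cluster (connGraph g (rooted z c.1) c.2) (some '' (s : Set (Fin n))) none).ncard =
      (cluster (connGraph g (rooted z (c.1 ∘ e)) (c.2 ∘ Sym2.map (Option.map e)))
        (some '' Set.univ) none).ncard := by
    intro c
    have := cluster_image (connGraph g (rooted z c.1) c.2) hinj (some '' Set.univ) none
    rw [Option.map_none] at this
    rw [hs, this, Set.ncard_image_of_injective _ hinj, connGraph_comap _ _ _ hinj, rooted_comp_map]
  simp_rw [h1]
  unfold annealedGreen
  rw [← hT.map_eq, integral_map hT.measurable.aemeasurable
    (measurable_fullGreen hd g q z).aestronglyMeasurable]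
  rfl

/-- After averaging over positions and edges only the size of ω matters, by exchangeability, and
that size is binomial. -/
theorem integral_siteGreen (hd : 0 < d) (g : ConnectionFunction d) {p q : ℝ} (hq : 0 ≤ q)
    (hq' : q ≤ 1) (z : Space d) (n : ℕ) :
    ∫ c, siteGreen p q (connGraph g (rooted z c.1) c.2) none ∂(modelLaw ν n) =
      ∑ k ∈ Finset.range (n + 1), (n.choose k : ℝ) *
        (p ^ k * (1 - p) ^ (n - k) * annealedGreen g q ν z k) := by
  unfold siteGreen
  rw [integral_finsetSum]
  · simp_rw [integral_const_mul, integral_cluster_eq_annealedGreen ν hd]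
    have := Finset.sum_powerset_apply_card
      (fun k => p ^ k * (1 - p) ^ (n - k) * annealedGreen g q ν z k)
      (x := (Finset.univ : Finset (Fin n)))
    rw [Finset.powerset_univ, Finset.card_univ, Fintype.card_fin] at this
    rw [this]
    simp
  · intro s _
    refine Integrable.const_mul ?_ _
    refine integrable_of_abs_le (M := 1) (measurable_connGraph_comp hd g (measurable_rooted.comp
      (measurable_const.prodMk measurable_fst)) measurable_snd fun G =>
        1 - (1 - q) ^ (cluster G (some '' (s : Set (Fin n))) none).ncard) fun c => ?_
    have := one_sub_pow_mem hq hq' (cluster (connGraph g (rooted z c.1) c.2)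
      (some '' (s : Set (Fin n))) none).ncard
    rw [abs_of_nonneg this.1]
    exact this.2

end Mean

/-! ### Normalisation to uniform points -/

section Conditional

variable {d : ℕ} {r : ℝ≥0} {P : Measure (ℕ → Space d)} {B : Set (Space d)}

theorem smul_restrict_eq_smul_cond (hB0 : volume B ≠ 0) (hB' : volume B ≠ ∞) :
    r • volume.restrict B = (meanCount r B : ℝ≥0∞) • cond volume B := by
  rw [ProbabilityTheory.cond, smul_smul, coe_meanCount hB', mul_assoc,
    ENNReal.mul_inv_cancel hB0 hB', mul_one]
  rfl

theorem pi_smul_restrict_eq (hB0 : volume B ≠ 0) (hB' : volume B ≠ ∞) (n : ℕ) :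
    (Measure.pi fun _ : Fin n => r • volume.restrict B) =
      (meanCount r B : ℝ≥0∞) ^ n • Measure.pi fun _ => cond volume B := by
  have := cond_isProbabilityMeasure_of_finite hB0 hB'
  have hfin : IsFiniteMeasure (volume.restrict B) := ⟨by simpa using hB'.lt_top⟩
  refine Measure.pi_eq fun s hs => ?_
  rw [smul_restrict_eq_smul_cond hB0 hB', Measure.smul_apply, Measure.pi_pi]
  simp [Finset.prod_mul_distrib]

/-- Given that there are `n` points of a Poisson process in `B`, they are independent and uniform,
in the sense that symmetric functionals have the corresponding mean. -/
theorem IsPoissonProcess.setLIntegral_count_eq_cond (hd : 0 < d) (hP : IsPoissonProcess r P)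
    (hB : MeasurableSet B) (hB0 : volume B ≠ 0) (hB' : volume B ≠ ∞) {n : ℕ}
    {Ψ : (ℕ → Space d) → ℝ≥0∞} {φ : (Fin n → Space d) → ℝ≥0∞} (hφ : Measurable φ)
    (h : ∀ X, ∀ i : Fin n ↪ ℕ, Set.range i = {j | X j ∈ B} → Ψ X = φ (X ∘ i)) :
    ∫⁻ X in {X | count B X = n}, Ψ X ∂P =
      poissonMeasure (meanCount r B) {n} * ∫⁻ x, φ x ∂(Measure.pi fun _ => cond volume B) := by
  rw [hP.setLIntegral_count_eq hd hB hB' hφ h, pi_smul_restrict_eq hB0 hB',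
    lintegral_smul_measure, smul_eq_mul, ← mul_assoc, poissonMeasure_singleton,
    ENNReal.ofReal_div_of_pos (by positivity), ENNReal.ofReal_mul (by positivity),
    ENNReal.ofReal_pow (by positivity)]
  simp only [ENNReal.ofReal_coe_nnreal, ENNReal.ofReal_natCast]
  rw [ENNReal.div_eq_inv_mul, ENNReal.div_eq_inv_mul, mul_assoc (_⁻¹)]

end Conditional

/-! ### Comparison with the infinite model -/

section MeanGreen

variable {d : ℕ} {r : ℝ≥0} {P : Measure (ℕ → Space d)}

/-- The half of Tonelli's theorem that survives without measurability of `S`; it spares a proof that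
the connection event in the infinite graph is measurable. -/
theorem lintegral_measure_preimage_le_prod {α β : Type*} [MeasurableSpace α] [MeasurableSpace β]
    (μ : Measure α) (ν : Measure β) [SFinite ν] (S : Set (α × β)) :
    ∫⁻ x, ν (Prod.mk x ⁻¹' S) ∂μ ≤ (μ.prod ν) S := by
  rw [← measure_toMeasurable S, Measure.prod_apply (measurableSet_toMeasurable _ _)]
  exact lintegral_mono fun x => measure_mono (Set.preimage_mono (subset_toMeasurable _ _))

theorem cluster_graph_eq_image (g : ConnectionFunction d) (c : Config d) {k : ℕ} (i : Fin k ↪ ℕ) :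
    cluster (graph g c) (some '' Set.range i) none = Option.map i ''
      cluster (connGraph g (rooted 0 (c.1 ∘ i)) (c.2 ∘ Sym2.map (Option.map i)))
        (some '' Set.univ) none := by
  rw [← graph_comap, ← cluster_image _ (Option.map_injective i.injective), ← Set.image_univ]
  congr 1
  ext v
  simp

theorem measure_connectedToGreen_eq (hd : 0 < d) (g : ConnectionFunction d) (q : I)
    (X : ℕ → Space d) {k : ℕ} (i : Fin k ↪ ℕ) :
    ((edgeLaw Label).prod (setBernoulli Set.univ q))
        {w | ConnectedToGreen (graph g (X, w.1)) (some '' Set.range i) w.2 none} =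
      ∫⁻ U, ENNReal.ofReal (fullGreen q (connGraph g (rooted 0 (X ∘ i)) U)) ∂(edgeLaw _) := by
  have hσ := Option.map_injective i.injective
  have hT := measurePreserving_edgeLaw hσ
  set G : (Sym2 Label → I) → SimpleGraph (Option (Fin k)) := fun U =>
    connGraph g (rooted 0 (X ∘ i)) (U ∘ Sym2.map (Option.map i)) with hG
  set C : SimpleGraph (Option (Fin k)) → Set Label := fun H =>
    Option.map i '' cluster H (some '' Set.univ) none with hC
  have hset : {w : (Sym2 Label → I) × Set Label |
      ConnectedToGreen (graph g (X, w.1)) (some '' Set.range i) w.2 none} =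
      {w | (C (G w.1) ∩ w.2).Nonempty} := by
    ext w
    simp only [Set.mem_ofPred_eq, connectedToGreen_iff, cluster_graph_eq_image g (X, w.1) i]
    rfl
  have hGm : ∀ H, MeasurableSet {U | G U = H} := fun H => by
    have := measurable_connGraph_comp hd g (y := fun _ : Sym2 Label → I => rooted 0 (X ∘ i))
      measurable_const hT.measurable (fun H' => H' = H)
    exact measurableSet_setOfPred.2 this
  have hmeas : MeasurableSet {w : (Sym2 Label → I) × Set Label | (C (G w.1) ∩ w.2).Nonempty} := by
    have : {w : (Sym2 Label → I) × Set Label | (C (G w.1) ∩ w.2).Nonempty} =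
        ⋃ H, {U | G U = H} ×ˢ {s | (C H ∩ s).Nonempty} := by
      ext w
      simp
    rw [this]
    exact MeasurableSet.iUnion fun H => (hGm H).prod (measurableSet_inter_nonempty _)
  rw [hset, Measure.prod_apply hmeas, ← hT.map_eq, lintegral_map ?_ hT.measurable]
  · refine lintegral_congr fun U => ?_
    change setBernoulli Set.univ q {s | (C (G U) ∩ s).Nonempty} = _
    rw [← ofReal_measureReal, setBernoulli_real_inter_nonempty (Set.subset_univ _) (Set.toFinite _),
      Set.ncard_image_of_injective _ hσ]
    rfl
  · exact (measurable_connGraph_comp hd g measurable_const measurable_id _).ennreal_ofReal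

/-- Translation by `-z` carries a root at `z` in the box `B` to the origin in a shifted box of the
same volume, where the process has the same conditional description. -/
theorem setLIntegral_connectedToGreen (hd : 0 < d) (g : ConnectionFunction d) (q : I)
    (hP : IsPoissonProcess r P) {B : Set (Space d)} (hB : MeasurableSet B)
    (hB0 : volume B ≠ 0) (hB' : volume B ≠ ∞) (z : Space d) (k : ℕ) :
    ∫⁻ X in {X | count ((fun x => x + z) ⁻¹' B) X = k},
      ((edgeLaw Label).prod (setBernoulli Set.univ q)) {w | ConnectedToGreen (graph g (X, w.1))
        (some '' {j | X j + z ∈ B}) w.2 none} ∂P =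
      poissonMeasure (meanCount r B) {k} *
        ENNReal.ofReal (annealedGreen g q (cond volume B) z k) := by
  have := cond_isProbabilityMeasure_of_finite hB0 hB'
  have hq := q.2.1
  have hq' := q.2.2
  set B' := (fun x => x + z) ⁻¹' B with hBdef
  have hvol : volume B' = volume B := measure_preimage_add_right volume z B
  have hBm : MeasurableSet B' := measurable_add_const z hB
  set φ : (Fin k → Space d) → ℝ≥0∞ := fun x =>
    ∫⁻ U, ENNReal.ofReal (fullGreen q (connGraph g (rooted 0 x) U)) ∂(edgeLaw _) with hφ
  have hφm : Measurable φ :=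
    (measurable_fullGreen hd g q 0).ennreal_ofReal.lintegral_prod_right'
  rw [hP.setLIntegral_count_eq_cond hd hBm (hvol ▸ hB0) (hvol ▸ hB') hφm]
  · have hmc : meanCount r B' = meanCount r B := by simp [meanCount, hvol]
    rw [hmc]
    congr 1
    have hmp : MeasurePreserving (fun x => x - z) (cond volume B) (cond volume B') := by
      have h1 := (measurePreserving_sub_right (volume : Measure (Space d)) z).restrict_preimage hBm
      have h2 : (fun x => x - z) ⁻¹' B' = B := by
        ext x; simp [hBdef]
      rw [h2] at h1
      unfold ProbabilityTheory.cond
      rw [hvol]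
      exact h1.smul_measure _
    have hpi := measurePreserving_pi (fun _ : Fin k => cond volume B)
      (fun _ => cond volume B') fun _ => hmp
    rw [← hpi.map_eq, lintegral_map hφm hpi.measurable]
    have hshift : ∀ (x : Fin k → Space d) U, connGraph g (rooted 0 fun j => x j - z) U =
        connGraph g (rooted z x) U := by
      intro x U
      ext v w
      cases v <;> cases w <;> simp [connGraph, rooted]
    simp only [hφ, hshift]
    rw [annealedGreen, ofReal_integral_eq_lintegral_ofReal, modelLaw, lintegral_prod]
    · exact (measurable_fullGreen hd g q z).ennreal_ofReal.aemeasurable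
    · refine integrable_of_abs_le (M := 1) (measurable_fullGreen hd g q z) fun c => ?_
      have h := one_sub_pow_mem hq hq' (cluster (connGraph g (rooted z c.1) c.2)
        (some '' Set.univ) none).ncard
      exact (abs_of_nonneg h.1).trans_le h.2
    · exact ae_of_all _ fun c => (one_sub_pow_mem hq hq' _).1
  · intro X i hi
    have : {j | X j + z ∈ B} = Set.range i := hi.symm
    rw [this]
    exact measure_connectedToGreen_eq hd g q X i

/-- The sum is the probability that the origin reaches a green vertex inside the shifted box while
the box holds fewer than `M` points. Components only grow when the box is replaced by the whole
space. -/
theorem sum_annealedGreen_le_meanGreen (hd : 0 < d) (g : ConnectionFunction d)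
    (hP : IsPoissonProcess r P) (h : ℝ≥0) {B : Set (Space d)} (hB : MeasurableSet B)
    (hB0 : volume B ≠ 0) (hB' : volume B ≠ ∞) (z : Space d) (M : ℕ) :
    ∑ k ∈ Finset.range M, Real.exp (-meanCount r B) * (meanCount r B : ℝ) ^ k / k.factorial *
      annealedGreen g (greenProb h) (cond volume B) z k ≤ meanGreen g P h := by
  have := hP.isProbabilityMeasure
  have := cond_isProbabilityMeasure_of_finite hB0 hB'
  set q := greenProb h
  have ha := fun k => annealedGreen_mem_Icc (cond volume B) g q.2.1 q.2.2 z k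
  set B' := (fun x => x + z) ⁻¹' B with hBdef
  have hBm : MeasurableSet B' := measurable_add_const z hB
  have hprob : IsProbabilityMeasure ((P.prod (edgeLaw Label)).prod
    (setBernoulli (Set.univ : Set Label) q)) := inferInstance
  set S : Set (Config d × Set Label) :=
    {z | ConnectedToGreen (graph g z.1) Set.univ z.2 none} with hS
  set S' : Set ((ℕ → Space d) × ((Sym2 Label → I) × Set Label)) :=
    {z | ConnectedToGreen (graph g (z.1, z.2.1)) Set.univ z.2.2 none} with hS'
  have hmeas : ((P.prod (edgeLaw Label)).prod (setBernoulli Set.univ q)) S =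
      (P.prod ((edgeLaw Label).prod (setBernoulli Set.univ q))) S' :=
    (measurePreserving_prodAssoc P (edgeLaw Label) (setBernoulli Set.univ q)).measure_preimage_equiv S'
  have hle : ∑ k ∈ Finset.range M, poissonMeasure (meanCount r B) {k} *
      ENNReal.ofReal (annealedGreen g q (cond volume B) z k) ≤
      ((P.prod (edgeLaw Label)).prod (setBernoulli Set.univ q)) S := by
    rw [hmeas]
    refine le_trans ?_ (lintegral_measure_preimage_le_prod _ _ _)
    simp_rw [← setLIntegral_connectedToGreen hd g q hP hB hB0 hB' z]
    rw [← lintegral_biUnion_finset]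
    · refine (setLIntegral_le_lintegral _ _).trans (lintegral_mono fun X => measure_mono ?_)
      intro w hw
      change ConnectedToGreen _ _ _ _ at hw
      change ConnectedToGreen _ _ _ _
      rw [connectedToGreen_iff] at hw ⊢
      exact hw.mono (Set.inter_subset_inter_left _ (cluster_mono _ (Set.subset_univ _) _))
    · intro k _ l _ hkl
      refine Set.disjoint_left.2 fun X hX hX' => hkl ?_
      exact_mod_cast (hX : count B' X = k).symm.trans hX'
    · exact fun k _ => measurableSet_count_eq hBm k
  have h2 := ENNReal.toReal_mono (measure_ne_top _ _) hle
  refine le_trans (le_of_eq ?_) h2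
  rw [ENNReal.toReal_sum fun k _ => ENNReal.mul_ne_top (measure_ne_top _ _) ENNReal.ofReal_ne_top]
  refine Finset.sum_congr rfl fun k _ => ?_
  rw [ENNReal.toReal_mul, ENNReal.toReal_ofReal (ha k).1, ← measureReal_def,
    poissonMeasure_real_singleton]

end MeanGreen

/-! ### Chernoff bound for the number of points -/

section PoissonTail

theorem poissonMeasure_exp (r : ℝ≥0) (t : ℝ) :
    Integrable (fun n : ℕ => Real.exp (t * n)) (poissonMeasure r) ∧
      mgf (fun n : ℕ => (n : ℝ)) (poissonMeasure r) t = Real.exp (r * (Real.exp t - 1)) := by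
  have h1 : HasSum (fun n : ℕ => Real.exp (-r) * r ^ n / n.factorial * Real.exp (t * n))
      (Real.exp (r * (Real.exp t - 1))) := by
    have h2 := NormedSpace.expSeries_div_hasSum_exp (𝔸 := ℝ) (r * Real.exp t)
    rw [← Real.exp_eq_exp_ℝ] at h2
    have h3 := h2.mul_left (Real.exp (-r))
    rw [← Real.exp_add] at h3
    rw [show r * (Real.exp t - 1) = -r + r * Real.exp t by ring]
    refine h3.congr_fun fun n => ?_
    rw [mul_pow, ← Real.exp_nat_mul, mul_comm t]
    ring
  constructor
  · rw [integrable_poissonMeasure_iff]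
    simpa only [Real.norm_eq_abs, Real.abs_exp] using h1.summable
  · rw [mgf, integral_poissonMeasure]
    exact h1.tsum_eq

theorem poissonMeasure_real_tail_le {μ η : ℝ} (hμ : 0 ≤ μ) (hη : 0 < η) :
    ∃ c : ℝ, 0 < c ∧ ∀ (N : ℕ) (r : ℝ≥0), (r : ℝ) = N * μ →
      (poissonMeasure r).real {n : ℕ | N * η < |(n : ℝ) - N * μ|} ≤ 2 * Real.exp (-(c * N)) := by
  -- The bound t ≤ 1 gives exp(s) - 1 - s ≤ s² for s = ±t; the other makes the quadratic cost μt² at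
  -- most half of the linear gain tη.
  set t : ℝ := min 1 (η / (2 * (μ + 1))) with ht
  have ht0 : 0 < t := by positivity
  have ht1 : |t| ≤ 1 := by rw [abs_of_pos ht0]; exact min_le_left _ _
  have htμ : μ * t ^ 2 ≤ t * η / 2 := by
    have h1 : t * (2 * (μ + 1)) ≤ η := by
      rw [← le_div_iff₀ (by positivity)]
      exact min_le_right _ _
    nlinarith
  refine ⟨t * η / 2, by positivity, fun N r hr => ?_⟩
  have hN : (0 : ℝ) ≤ N := N.cast_nonneg
  have hside : ∀ s : ℝ, s ^ 2 = t ^ 2 → |s| ≤ 1 →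
      Real.exp (-(s * (N * μ)) - t * (N * η)) * Real.exp (r * (Real.exp s - 1)) ≤
        Real.exp (-(t * η / 2 * N)) := by
    intro s hs hs1
    rw [← Real.exp_add, hr]
    refine Real.exp_le_exp.2 ?_
    have h1 := (abs_le.1 (Real.abs_exp_sub_one_sub_id_le hs1)).2
    have h2 : N * (μ * (Real.exp s - 1 - s)) ≤ N * (t * η / 2) := by
      gcongr
      exact (mul_le_mul_of_nonneg_left (h1.trans hs.le) hμ).trans htμ
    linarith
  have hup := measure_ge_le_exp_mul_mgf (μ := poissonMeasure r) (X := fun n : ℕ => (n : ℝ))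
    (N * μ + N * η) ht0.le (poissonMeasure_exp r t).1
  have hlo := measure_le_le_exp_mul_mgf (μ := poissonMeasure r) (X := fun n : ℕ => (n : ℝ))
    (N * μ - N * η) (neg_nonpos.2 ht0.le) (poissonMeasure_exp r (-t)).1
  rw [(poissonMeasure_exp r _).2] at hup hlo
  rw [show -t * (N * μ + N * η) = -(t * (N * μ)) - t * (N * η) by ring] at hup
  rw [show - -t * (N * μ - N * η) = -(-t * (N * μ)) - t * (N * η) by ring] at hlo
  have hup' := hup.trans (hside t rfl ht1)
  have hlo' := hlo.trans (hside (-t) (by ring) (by rwa [abs_neg]))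
  have hsub : {n : ℕ | N * η < |(n : ℝ) - N * μ|} ⊆
      {n : ℕ | N * μ + N * η ≤ n} ∪ {n : ℕ | (n : ℝ) ≤ N * μ - N * η} := by
    intro n hn
    have hn' : N * η < |(n : ℝ) - N * μ| := hn
    rcases lt_abs.1 hn' with h | h
    · exact Or.inl (show N * μ + N * η ≤ (n : ℝ) by linarith)
    · exact Or.inr (show (n : ℝ) ≤ N * μ - N * η by linarith)
  calc _ ≤ _ := measureReal_mono hsub
    _ ≤ _ := measureReal_union_le _ _
    _ ≤ _ := by linarith

end PoissonTail

/-! ### Volume of the box -/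

section Box

theorem box_eq_preimage (d : ℕ) (r : ℝ) : box d r =
    (MeasurableEquiv.toLp 2 (Fin d → ℝ)).symm ⁻¹'
      Set.univ.pi fun _ => Set.Ico (-(r / 2)) (r / 2) := by
  ext y
  simp [box]

theorem measurableSet_box (d : ℕ) (r : ℝ) : MeasurableSet (box d r) := by
  rw [box_eq_preimage]
  exact MeasurableEquiv.measurable _ (MeasurableSet.univ_pi fun _ => measurableSet_Ico)

theorem volume_box (d : ℕ) (r : ℝ) : volume (box d r) = ENNReal.ofReal r ^ d := by
  rw [box_eq_preimage, (EuclideanSpace.volume_preserving_symm_measurableEquiv_toLp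
    (Fin d)).measure_preimage_equiv, volume_pi_pi]
  simp

end Box

/-! ### Union bound over the vertices -/

section FiniteModel

variable {d : ℕ}

theorem rooted_comp_rerooted {m : ℕ} (x : Fin (m + 1) → Space d) (k : Fin (m + 1)) :
    rooted 0 x ∘ rerooted k = rooted (x k) (x ∘ k.succAbove) := by
  ext v : 1
  cases v <;> rfl

theorem measurePreserving_reroot (ν : Measure (Space d)) [IsProbabilityMeasure ν] {m : ℕ}
    (k : Fin (m + 1)) :
    MeasurePreserving (fun c : (Fin (m + 1) → Space d) × (Sym2 (Option (Fin (m + 1))) → I) =>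
      (c.1 k, (c.1 ∘ k.succAbove, c.2 ∘ Sym2.map (rerooted k))))
      (modelLaw ν (m + 1)) (ν.prod (modelLaw ν m)) := by
  have h1 := measurePreserving_piFinSuccAbove (fun _ : Fin (m + 1) => ν) k
  have h2 := measurePreserving_edgeLaw (rerooted_injective k)
  have h3 := (measurePreserving_prodAssoc ν (Measure.pi fun _ : Fin m => ν)
    (edgeLaw (Option (Fin m)))).comp (h1.prod h2)
  exact h3

/-- Given its position z, a point serves as the root of a model with the other n - 1 points, while
the origin sees all n. Hence the mean is required for m = n and m = n - 1, and for every z. -/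
theorem modelLaw_exists_le (hd : 0 < d) (g : ConnectionFunction d)
    (ν : Measure (Space d)) [IsProbabilityMeasure ν] {p q : ℝ} (hp : 0 < p) (hp' : p ≤ 1)
    (hq : 0 ≤ q) (hq' : q ≤ 1) (n : ℕ) {T δ : ℝ} (hδ : 0 ≤ δ)
    (hmean : ∀ m ≤ n, n ≤ m + 1 → ∀ z, ∫ c, siteGreen p q (connGraph g (rooted z c.1) c.2) none
        ∂(modelLaw ν m) + δ ≤ T) :
    modelLaw ν n {c | ∃ u, T < siteGreen p q (connGraph g (rooted 0 c.1) c.2) u} ≤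
      (n + 1 : ℕ) * ENNReal.ofReal (Real.exp (-(δ ^ 2 / (2 * (n + 1) * p ^ 2)))) := by
  set ε := ENNReal.ofReal (Real.exp (-(δ ^ 2 / (2 * (n + 1) * p ^ 2)))) with hε
  have hroot : ∀ m ≤ n, n ≤ m + 1 → ∀ z,
      modelLaw ν m {c | T < siteGreen p q (connGraph g (rooted z c.1) c.2) none} ≤ ε := by
    intro m hmn hnm z
    rw [← ofReal_measureReal]
    refine ENNReal.ofReal_le_ofReal ?_
    refine (measureReal_mono (fun c hc => ?_)).trans
      ((modelLaw_real_ge_le hd g ν hp hp' hq hq' m z hδ).trans ?_)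
    · exact (hmean m hmn hnm z).trans (le_of_lt hc)
    · gcongr
  have hu : ∀ u, modelLaw ν n {c | T < siteGreen p q (connGraph g (rooted 0 c.1) c.2) u} ≤ ε := by
    rintro (_ | k)
    · exact hroot n le_rfl n.le_succ 0
    · obtain ⟨m, rfl⟩ : ∃ m, n = m + 1 := ⟨n - 1, by have := k.pos; omega⟩
      have hT := measurePreserving_reroot ν k
      set S : Set (Space d × ((Fin m → Space d) × (Sym2 (Option (Fin m)) → I))) :=
        {w | T < siteGreen p q (connGraph g (rooted w.1 w.2.1) w.2.2) none} with hS
      have hSm : MeasurableSet S := by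
        refine measurableSet_lt measurable_const
          (measurable_connGraph_comp hd g (V := Option (Fin m)) ?_ ?_ fun G => siteGreen p q G none)
        · exact measurable_rooted.comp (measurable_fst.prodMk (measurable_fst.comp measurable_snd))
        · exact measurable_snd.comp measurable_snd
      have hset : {c : (Fin (m + 1) → Space d) × (Sym2 (Option (Fin (m + 1))) → I) |
          T < siteGreen p q (connGraph g (rooted 0 c.1) c.2) (some k)} =
          (fun c => (c.1 k, (c.1 ∘ k.succAbove, c.2 ∘ Sym2.map (rerooted k)))) ⁻¹' S := by
        ext c
        simp only [Set.mem_ofPred_eq, Set.mem_preimage, hS]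
        rw [siteGreen_some, connGraph_comap _ _ _ (rerooted_injective k), rooted_comp_rerooted]
      rw [hset, hT.measure_preimage hSm.nullMeasurableSet, Measure.prod_apply hSm]
      calc _ ≤ ∫⁻ _, ε ∂ν := lintegral_mono fun z => hroot m (Nat.le_succ m) le_rfl z
        _ = ε := by simp
  have hset : {c : (Fin n → Space d) × (Sym2 (Option (Fin n)) → I) |
      ∃ u, T < siteGreen p q (connGraph g (rooted 0 c.1) c.2) u} =
      ⋃ u, {c | T < siteGreen p q (connGraph g (rooted 0 c.1) c.2) u} := by
    ext c; simp
  rw [hset]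
  refine (measure_iUnion_fintype_le _ _).trans ((Finset.sum_le_sum fun u _ => hu u).trans ?_)
  simp

theorem measurableSet_exists_siteGreen (hd : 0 < d) (g : ConnectionFunction d) (p q T : ℝ) (n : ℕ) :
    MeasurableSet {c : (Fin n → Space d) × (Sym2 (Option (Fin n)) → I) |
      ∃ u, T < siteGreen p q (connGraph g (rooted 0 c.1) c.2) u} := by
  have := measurable_connGraph_comp hd g (V := Option (Fin n))
    (y := fun c : (Fin n → Space d) × (Sym2 (Option (Fin n)) → I) => rooted 0 c.1)
    (U := fun c => c.2) (measurable_rooted.comp (measurable_const.prodMk measurable_fst))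
    measurable_snd (fun G => ∃ u, T < siteGreen p q G u)
  exact measurableSet_setOfPred.2 this

end FiniteModel

/-! ### Transfer to the Poisson model -/

section BadEvent

variable {d : ℕ} {r : ℝ≥0} {P : Measure (ℕ → Space d)}

/-- There are `n` points in the box, and the conditional probability exceeds `T` for one of them. -/
def badEvent (g : ConnectionFunction d) (K N : ℕ) (h : ℝ≥0) (T : ℝ) (n : ℕ) : Set (Config d) :=
  {c | count (box d K) c.1 = n ∧ ∃ v ∈ boxVertices K c, T < condGreen g K N h c v}

theorem exists_condGreen_iff (g : ConnectionFunction d) (K N : ℕ) (h : ℝ≥0) (T : ℝ) (c : Config d)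
    {n : ℕ} (i : Fin n ↪ ℕ) (hi : Set.range i = {j | c.1 j ∈ box d K}) :
    (∃ v ∈ boxVertices K c, T < condGreen g K N h c v) ↔ ∃ u, T < siteGreen (siteProb N)
      (greenProb h) (connGraph g (rooted 0 (c.1 ∘ i)) (c.2 ∘ Sym2.map (Option.map i))) u := by
  have hW : ∀ v, v ∈ boxVertices K c ↔ ∃ u, Option.map i u = v := by
    have hj : ∀ j, c.1 j ∈ box d K ↔ ∃ a, i a = j := fun j => by
      change j ∈ {j | c.1 j ∈ box d K} ↔ _
      rw [← hi]; rfl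
    rintro (_ | j)
    · exact ⟨fun _ => ⟨none, rfl⟩, fun _ => Set.mem_insert _ _⟩
    · simp [boxVertices, hj, Option.exists, eq_comm]
  rw [← graph_comap]
  constructor
  · rintro ⟨v, hv, hT⟩
    obtain ⟨u, rfl⟩ := (hW v).1 hv
    exact ⟨u, condGreen_eq g K N h c i hi u ▸ hT⟩
  · rintro ⟨u, hT⟩
    exact ⟨Option.map i u, (hW _).2 ⟨u, rfl⟩, (condGreen_eq g K N h c i hi u).symm ▸ hT⟩

theorem exists_embedding_of_count_eq {n : ℕ} {B : Set (Space d)} {X : ℕ → Space d}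
    (hX : count B X = n) : ∃ i : Fin n ↪ ℕ, Set.range i = {j | X j ∈ B} := by
  have hfin : {j | X j ∈ B}.Finite := by
    rw [← Set.encard_ne_top_iff]
    exact ne_of_eq_of_ne hX (by simp)
  have hcard : hfin.toFinset.card = n := by
    have : {j | X j ∈ B}.encard = n := hX
    rw [hfin.encard_eq_coe_toFinset_card] at this
    exact_mod_cast this
  refine ⟨(hfin.toFinset.orderEmbOfFin hcard).toEmbedding, ?_⟩
  simp

theorem rcmLaw_badEvent (hd : 0 < d) (g : ConnectionFunction d) (hP : IsPoissonProcess r P)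
    {K : ℕ} (hK : 0 < K) (N : ℕ) (h : ℝ≥0) (T : ℝ) (n : ℕ) :
    rcmLaw P (badEvent g K N h T n) = poissonMeasure (meanCount r (box d K)) {n} *
      modelLaw (cond volume (box d K)) n {c | ∃ u, T < siteGreen (siteProb N) (greenProb h)
        (connGraph g (rooted 0 c.1) c.2) u} := by
  have := hP.isProbabilityMeasure
  set B := box d K with hBdef
  have hB : MeasurableSet B := measurableSet_box d K
  have hB0 : volume B ≠ 0 := by
    rw [hBdef, volume_box]
    exact pow_ne_zero _ (by simpa using hK.ne')
  have hB' : volume B ≠ ∞ := by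
    rw [hBdef, volume_box]; exact ENNReal.pow_ne_top ENNReal.ofReal_ne_top
  have := cond_isProbabilityMeasure_of_finite hB0 hB'
  set S := {c : (Fin n → Space d) × (Sym2 (Option (Fin n)) → I) | ∃ u, T < siteGreen (siteProb N)
    (greenProb h) (connGraph g (rooted 0 c.1) c.2) u} with hS
  have hSm : MeasurableSet S := measurableSet_exists_siteGreen hd g _ _ T n
  have hred : ∀ i : Fin n ↪ ℕ, Measurable fun c : Config d =>
      (c.1 ∘ i, c.2 ∘ Sym2.map (Option.map i)) := fun i =>
    ((measurable_comp_embedding i).comp measurable_fst).prodMk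
      ((measurePreserving_edgeLaw (Option.map_injective i.injective)).measurable.comp
        measurable_snd)
  -- Measurability comes from this countable union over enumerations of the points in the box: for
  -- each one the condition is an event of the finite model.
  have hbad : badEvent g K N h T n = ⋃ i : Fin n ↪ ℕ,
      (Prod.fst ⁻¹' ({X | count B X = n} ∩ {X | ∀ j, X (i j) ∈ B})) ∩
        (fun c : Config d => (c.1 ∘ i, c.2 ∘ Sym2.map (Option.map i))) ⁻¹' S := by
    ext c
    simp only [badEvent, Set.mem_ofPred_eq, Set.mem_iUnion, Set.mem_inter_iff, Set.mem_preimage]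
    constructor
    · rintro ⟨hc, hex⟩
      obtain ⟨i, hi⟩ := exists_embedding_of_count_eq hc
      refine ⟨i, ⟨hc, fun j => ?_⟩, (exists_condGreen_iff g K N h T c i hi).1 hex⟩
      have : i j ∈ {j | c.1 j ∈ B} := hi ▸ ⟨j, rfl⟩
      exact this
    · rintro ⟨i, ⟨hc, hi⟩, hmem⟩
      exact ⟨hc, (exists_condGreen_iff g K N h T c i (range_eq_of_count_eq hc i hi)).2 hmem⟩
  have hbadm : MeasurableSet (badEvent g K N h T n) := by
    rw [hbad]
    exact MeasurableSet.iUnion fun i => (measurable_fst ((measurableSet_count_eq hB n).inter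
      (measurableSet_forall_mem hB i))).inter (hred i hSm)
  set Ψ : (ℕ → Space d) → ℝ≥0∞ := fun X => edgeLaw Label
    {U | ∃ v ∈ boxVertices K (X, U), T < condGreen g K N h (X, U) v} with hΨ
  have hsec : ∀ X, edgeLaw Label (Prod.mk X ⁻¹' badEvent g K N h T n) =
      {X | count B X = n}.indicator Ψ X := by
    intro X
    by_cases hX : X ∈ {X : ℕ → Space d | count B X = n}
    · rw [Set.indicator_of_mem hX]
      congr 1
      ext U
      exact and_iff_right hX
    · rw [Set.indicator_of_notMem hX]
      have : Prod.mk X ⁻¹' badEvent g K N h T n = ∅ :=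
        Set.eq_empty_of_forall_notMem fun U hU => hX hU.1
      rw [this, measure_empty]
  have hprod : rcmLaw P (badEvent g K N h T n) = ∫⁻ X in {X | count B X = n}, Ψ X ∂P := by
    rw [← lintegral_indicator (measurableSet_count_eq hB n)]
    simp_rw [← hsec]
    exact Measure.prod_apply hbadm
  rw [hprod, hP.setLIntegral_count_eq_cond hd hB hB0 hB'
    (φ := fun x => edgeLaw _ (Prod.mk x ⁻¹' S)) (measurable_measure_prodMk_left hSm)]
  · rw [modelLaw, Measure.prod_apply hSm]
  · intro X i hi
    have hT := measurePreserving_edgeLaw (Option.map_injective i.injective)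
    rw [← hT.measure_preimage (measurable_prodMk_left hSm).nullMeasurableSet]
    simp only [hΨ]
    congr 1
    ext U
    exact exists_condGreen_iff g K N h T (X, U) i hi

end BadEvent

/-! ### Combining the estimates -/

section Main

variable {d : ℕ}

theorem integral_siteGreen_add_le (hd : 0 < d) (g : ConnectionFunction d) {lam : ℝ≥0}
    {P : Measure (ℕ → Space d)} (hP : IsPoissonProcess lam P) (h : ℝ≥0) {B : Set (Space d)}
    (hB : MeasurableSet B) (hB0 : volume B ≠ 0) (hB' : volume B ≠ ∞) {δ η : ℝ} (hη : 0 < η)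
    (hηδ : Real.exp (2 * η) - 1 ≤ δ / 2) {N n m : ℕ} (hN : 0 < N) (hNη : 2 ≤ N * η)
    (hexp : (meanCount lam B + η / 2) * Real.exp (1 / N) ≤ meanCount lam B + η)
    (hn : |(n : ℝ) - N * meanCount lam B| ≤ N * (η / 2)) (hmn : m ≤ n) (hnm : n ≤ m + 1)
    (z : Space d) :
    ∫ c, siteGreen (siteProb N) (greenProb h) (connGraph g (rooted z c.1) c.2) none
      ∂(modelLaw (cond volume B) m) + δ / 2 ≤ meanGreen g P h + δ := by
  have := cond_isProbabilityMeasure_of_finite hB0 hB'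
  set μ : ℝ := NNReal.toReal (meanCount lam B) with hμ
  have hμ0 : 0 ≤ μ := NNReal.coe_nonneg _
  set q := greenProb h
  have hN' : (0 : ℝ) < N := by exact_mod_cast hN
  have ha := annealedGreen_mem_Icc (cond volume B) g q.2.1 q.2.2 z
  have hmn' : (m : ℝ) ≤ n := by exact_mod_cast hmn
  have hnm' : (n : ℝ) ≤ m + 1 := by exact_mod_cast hnm
  obtain ⟨hn1, hn2⟩ := abs_le.1 hn
  have hp : ((siteProb N : I) : ℝ) = 1 / N := rfl
  -- Here m ≥ n - 1, and 2 ≤ Nη absorbs the point that may be missing.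
  have hlow : μ - η ≤ m * (siteProb N : ℝ) := by
    rw [hp, mul_one_div, le_div_iff₀ hN']
    linarith
  have hup : m * (siteProb N : ℝ) ≤ μ + η / 2 := by
    rw [hp, mul_one_div, div_le_iff₀ hN']
    linarith
  have hmain := sum_binomial_le_of_sum_poisson_le (n := m) (b := μ - η) (w := μ + η)
    (fun k => (ha k).1) (fun k => (ha k).2)
    (sum_annealedGreen_le_meanGreen hd g hP h hB hB0 hB' z) hμ0 (by linarith) (by linarith) hlow
    ((mul_le_mul_of_nonneg_right hup (Real.exp_pos _).le).trans hexp)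
    (siteProb N).2.1 (siteProb N).2.2
  rw [show μ + η - (μ - η) = 2 * η by ring] at hmain
  rw [integral_siteGreen _ hd g q.2.1 q.2.2]
  linarith

theorem meanCount_natCast_mul (N : ℕ) (lam : ℝ≥0) (B : Set (Space d)) :
    (meanCount (N * lam) B : ℝ) = N * meanCount lam B := by
  simp [meanCount, mul_assoc]

/-- Atypical counts are charged to the Poisson tail. Every typical count has conditional failure
probability at most `D`, and the Poisson weights sum to 1. -/
theorem rcmLaw_condGreen_le (hd : 0 < d) (g : ConnectionFunction d) {lam : ℝ≥0}
    {P Q : Measure (ℕ → Space d)} (hP : IsPoissonProcess lam P) {K : ℕ} (hK : 0 < K) (h : ℝ≥0)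
    {δ η : ℝ} (hδ : 0 < δ) (hη : 0 < η) (hηδ : Real.exp (2 * η) - 1 ≤ δ / 2) {N : ℕ} (hN : 0 < N)
    (hQ : IsPoissonProcess (N * lam) Q) (hNη : 2 ≤ N * η)
    (hexp : (meanCount lam (box d K) + η / 2) * Real.exp (1 / N) ≤ meanCount lam (box d K) + η) :
    rcmLaw Q {c | meanGreen g P h + δ < ⨆ v : boxVertices K c, condGreen g K N h c v} ≤
      poissonMeasure (meanCount (N * lam) (box d K))
        {n : ℕ | N * (η / 2) < |(n : ℝ) - N * meanCount lam (box d K)|} +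
      ENNReal.ofReal (N * (meanCount lam (box d K) + η) *
        Real.exp (-((δ / 2) ^ 2 / (2 * (meanCount lam (box d K) + η)) * N))) := by
  have := hQ.isProbabilityMeasure
  set B := box d K with hBdef
  have hB : MeasurableSet B := measurableSet_box d K
  have hB0 : volume B ≠ 0 := by
    rw [hBdef, volume_box]
    exact pow_ne_zero _ (by simpa using hK.ne')
  have hB' : volume B ≠ ∞ := by
    rw [hBdef, volume_box]; exact ENNReal.pow_ne_top ENNReal.ofReal_ne_top
  have := cond_isProbabilityMeasure_of_finite hB0 hB'
  set μ : ℝ := NNReal.toReal (meanCount lam B) with hμ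
  have hμ0 : 0 ≤ μ := NNReal.coe_nonneg _
  set T := meanGreen g P h + δ with hT
  set W : Set ℕ := {n : ℕ | N * (η / 2) < |(n : ℝ) - N * μ|} with hW
  set D := ENNReal.ofReal (N * (μ + η) * Real.exp (-((δ / 2) ^ 2 / (2 * (μ + η)) * N))) with hD
  have hN' : (0 : ℝ) < N := by exact_mod_cast hN
  have hbad : ∀ n ∉ W, rcmLaw Q (badEvent g K N h T n) ≤
      poissonMeasure (meanCount (N * lam) B) {n} * D := by
    intro n hn
    have hn' : |(n : ℝ) - N * μ| ≤ N * (η / 2) := not_lt.1 hn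
    rw [rcmLaw_badEvent hd g hQ hK]
    gcongr
    have hp : ((siteProb N : I) : ℝ) = 1 / N := rfl
    refine (modelLaw_exists_le hd g (cond volume B) (p := siteProb N) (by rw [hp]; positivity)
      (siteProb N).2.2 (greenProb h).2.1 (greenProb h).2.2 n (δ := δ / 2) (by positivity)
      fun m hmn hnm z => integral_siteGreen_add_le hd g hP h hB hB0 hB' hη hηδ hN hNη hexp hn' hmn
        hnm z).trans ?_
    rw [← ENNReal.ofReal_natCast, ← ENNReal.ofReal_mul (by positivity)]
    refine ENNReal.ofReal_le_ofReal ?_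
    -- The extra 1 is at most Nη/2; both the number of vertices and the exponent thereby become
    -- functions of N alone.
    have hle : (n : ℝ) + 1 ≤ N * (μ + η) := by
      have := (abs_le.1 hn').2
      linarith
    push_cast
    gcongr
    rw [hp, div_mul_eq_mul_div, div_le_div_iff₀ (by positivity) (by positivity)]
    have : (2 * ((n : ℝ) + 1) * (1 / N) ^ 2) * N ≤ 2 * (μ + η) := by
      rw [one_div, inv_pow, sq, mul_inv]
      field_simp
      linarith
    calc (δ / 2) ^ 2 * N * (2 * (n + 1) * (1 / (N : ℝ)) ^ 2)
        = (δ / 2) ^ 2 * ((2 * ((n : ℝ) + 1) * (1 / N) ^ 2) * N) := by ring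
      _ ≤ _ := by gcongr
  -- An infinite count is not the cast of a natural number, so it falls into the first set.
  have hsub : {c | T < ⨆ v : boxVertices K c, condGreen g K N h c v} ⊆
      Prod.fst ⁻¹' {X | count B X ∉ (Nat.cast : ℕ → ℕ∞) '' Wᶜ} ∪
        ⋃ n : ℕ, ⋃ _ : n ∉ W, badEvent g K N h T n := by
    intro c hc
    have : Nonempty (boxVertices K c) := ⟨⟨none, Set.mem_insert _ _⟩⟩
    obtain ⟨v, hv⟩ := exists_lt_of_lt_ciSup (show T < ⨆ v : boxVertices K c, _ from hc)
    by_cases hcount : count B c.1 ∈ (Nat.cast : ℕ → ℕ∞) '' Wᶜ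
    · obtain ⟨n, hn, hcn⟩ := hcount
      exact Or.inr (Set.mem_iUnion₂.2 ⟨n, hn, hcn.symm, v, v.2, hv⟩)
    · exact Or.inl hcount
  have htail : rcmLaw Q (Prod.fst ⁻¹' {X | count B X ∉ (Nat.cast : ℕ → ℕ∞) '' Wᶜ}) =
      poissonMeasure (meanCount (N * lam) B) W := by
    have hm : MeasurableSet ((Nat.cast : ℕ → ℕ∞) '' Wᶜ)ᶜ := MeasurableSet.of_discrete
    have h1 : rcmLaw Q (Prod.fst ⁻¹' {X | count B X ∉ (Nat.cast : ℕ → ℕ∞) '' Wᶜ}) =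
        Q {X | count B X ∉ (Nat.cast : ℕ → ℕ∞) '' Wᶜ} :=
      measurePreserving_fst.measure_preimage (measurable_count hB hm).nullMeasurableSet
    have h2 : Q {X | count B X ∉ (Nat.cast : ℕ → ℕ∞) '' Wᶜ} =
        Q.map (count B) ((Nat.cast : ℕ → ℕ∞) '' Wᶜ)ᶜ := by
      rw [Measure.map_apply (measurable_count hB) hm]
      rfl
    rw [h1, h2, (hQ.hasLaw_count B hB hB'.lt_top).map_eq, Measure.map_apply (by fun_prop) hm]
    congr 1
    ext n
    simp
  refine (measure_mono hsub).trans ((measure_union_le _ _).trans ?_)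
  rw [htail]
  gcongr
  calc _ ≤ ∑' n : ℕ, rcmLaw Q (⋃ _ : n ∉ W, badEvent g K N h T n) := measure_iUnion_le _
    _ ≤ ∑' n : ℕ, poissonMeasure (meanCount (N * lam) B) {n} * D := by
        refine ENNReal.tsum_le_tsum fun n => ?_
        by_cases hn : n ∈ W
        · simp [hn]
        · simpa [hn] using hbad n hn
    _ = D := by
        have := Measure.tsum_indicator_apply_singleton
          (poissonMeasure (meanCount (N * lam) B)) Set.univ MeasurableSet.univ
        simp only [Set.indicator_univ, measure_univ] at this
        rw [ENNReal.tsum_mul_right, this, one_mul]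

end Main

end RCM

/-! ### Choice of constants and the limit -/

theorem mainTheorem3 (d : ℕ) (hd : 0 < d) (g : RCM.ConnectionFunction d)
    (P : ℝ≥0 → Measure (ℕ → RCM.Space d))
    (hP : ∀ r : ℝ≥0, 0 < r → RCM.IsPoissonProcess r (P r))
    (K : ℕ) (hK : 0 < K) (lam : ℝ≥0) (hlam : 0 < lam) (h : ℝ≥0) (hh : 0 < h)
    (δ : ℝ) (hδ : 0 < δ) :
    Tendsto (fun N : ℕ => RCM.rcmLaw (P (N * lam))
        {c | RCM.meanGreen g (P lam) h + δ <
          ⨆ v : RCM.boxVertices K c, RCM.condGreen g K N h c v})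
      atTop (𝓝 0) := by
  set μ : ℝ := NNReal.toReal (RCM.meanCount lam (RCM.box d K)) with hμ
  have hμ0 : 0 ≤ μ := NNReal.coe_nonneg _
  obtain ⟨η, hη, hηδ⟩ : ∃ η : ℝ, 0 < η ∧ Real.exp (2 * η) - 1 ≤ δ / 2 := by
    -- The solution of exp(2η) - 1 = δ/2: the binomial-to-Poisson error uses half of δ,
    -- concentration the other half.
    refine ⟨Real.log (1 + δ / 2) / 2, ?_, ?_⟩
    · have := Real.log_pos (show 1 < 1 + δ / 2 by linarith)
      positivity
    · rw [mul_div_cancel₀ _ two_ne_zero, Real.exp_log (by positivity)]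
      linarith
  obtain ⟨c, hc, htail⟩ := RCM.poissonMeasure_real_tail_le hμ0 (half_pos hη)
  set c' := (δ / 2) ^ 2 / (2 * (μ + η)) with hc'
  have hc'0 : 0 < c' := by positivity
  have hev : ∀ᶠ N : ℕ in atTop, (μ + η / 2) * Real.exp (1 / N) ≤ μ + η := by
    have h1 : Tendsto (fun N : ℕ => (μ + η / 2) * Real.exp (1 / N)) atTop (𝓝 ((μ + η / 2) * 1)) := by
      refine Tendsto.const_mul _ ?_
      have h0 := (Real.continuous_exp.tendsto 0).comp
        (tendsto_one_div_atTop_nhds_zero_nat (𝕜 := ℝ))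
      rwa [Real.exp_zero] at h0
    exact (h1.eventually_lt_const (by linarith)).mono fun N hN => hN.le
  have hev' : ∀ᶠ N : ℕ in atTop, 2 ≤ N * η :=
    (tendsto_natCast_atTop_atTop.atTop_mul_const hη).eventually_ge_atTop 2
  -- The linear factor N from the union bound loses against the exponential.
  have hlim : Tendsto (fun N : ℕ => ENNReal.ofReal (2 * Real.exp (-(c * N))) +
      ENNReal.ofReal (N * (μ + η) * Real.exp (-(c' * N)))) atTop (𝓝 0) := by
    have hpow : ∀ (a : ℝ) (N : ℕ), Real.exp (-(a * N)) = Real.exp (-a) ^ N := fun a N => by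
      rw [← Real.exp_nat_mul]; ring_nf
    have hlt : ∀ a : ℝ, 0 < a → Real.exp (-a) < 1 := fun a ha => by
      rw [Real.exp_lt_one_iff]; linarith
    have h1 : Tendsto (fun N : ℕ => 2 * Real.exp (-(c * N))) atTop (𝓝 (2 * 0)) := by
      simp_rw [hpow]
      exact (tendsto_pow_atTop_nhds_zero_of_lt_one (Real.exp_pos _).le (hlt c hc)).const_mul 2
    have h2 : Tendsto (fun N : ℕ => (N : ℝ) * (μ + η) * Real.exp (-(c' * N))) atTop
        (𝓝 ((μ + η) * 0)) := by
      simp_rw [hpow]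
      refine ((tendsto_self_mul_const_pow_of_lt_one (Real.exp_pos _).le
        (hlt c' hc'0)).const_mul (μ + η)).congr fun N => ?_
      ring
    have h3 := (ENNReal.tendsto_ofReal h1).add (ENNReal.tendsto_ofReal h2)
    simpa using h3
  refine tendsto_of_tendsto_of_tendsto_of_le_of_le' tendsto_const_nhds hlim
    (Eventually.of_forall fun _ => zero_le) ?_
  filter_upwards [hev, hev', eventually_gt_atTop 0] with N hN1 hN2 hN
  refine (RCM.rcmLaw_condGreen_le hd g (hP lam hlam) hK h hδ hη hηδ hN
    (hP _ (by positivity)) hN2 hN1).trans ?_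
  gcongr
  rw [← ofReal_measureReal]
  exact ENNReal.ofReal_le_ofReal (htail N _ (RCM.meanCount_natCast_mul N lam _))
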